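/- Let $N\ge 3$ and let $S^{N-1}$ be the unit sphere of $\mathbb R^N$ with its round metric, its intrinsic (great-circle) distance and its surface measure $\mathcal H^{N-1}$. For $\eta>0$ let $S_+(\eta)=\{\xi\in S^{N-1}:\xi_N>\eta\}$. For $\eta,r>0$ let $\Pi_+(\eta,r)$ be the class of open sets $A\subset S^{N-1}$ whose closure is contained in $S_+(\eta)$ and such that for every $x\in\partial A$ there are open geodesic balls $B_r^+\subset A$ and $B_r^-\subset S^{N-1}\setminus A$ of radius $r$ with $x\in\partial B_r^+\cap\partial B_r^-$. For an open set $A\subset S^{N-1}$ let $W^{1,2}(A)$ be the completion of the space of smooth functions $u$ on $A$ with finite norm $(\|u\|_{L^2(A)}^2+\|\nabla u\|_{L^2(A)}^2)^{1/2}$ with respect to this norm, where $\nabla$ is the gradient on the sphere, and for $A\neq\emptyset$ set $$\mu_1(A)=\inf\Big\{\frac{\|\nabla u\|_{L^2(A)}}{\|u\|_{L^2(A)}}: u\in W^{1,2}(A),\ \int_A u\,d\mathcal H^{N-1}=0,\ u\not\equiv 0\Big\}.$$ For $X,Y\subset S^{N-1}$ let $d_{L^\infty}(\partial X,\partial Y)$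 be the Hausdorff distance between $\partial X$ and $\partial Y$ with respect to the intrinsic distance of the sphere. Then for all $N\ge 3$, $\eta>0$, $r>0$ and every $\epsilon>0$ there is $\delta>0$ such that for all non-empty $A,A'\in\Pi_+(\eta,r)$, $d_{L^\infty}(\partial A',\partial A)<\delta$ implies $|\mu_1(A')-\mu_1(A)|<\epsilon$. -/

import Mathlib

open MeasureTheory
open scoped Manifold ContDiff ENNReal

noncomputable section

namespace AlmostConvexCones

/-- The ambient Euclidean space `ℝ^N`, where `N = n + 1`. -/
abbrev Amb (n : ℕ) : Type := EuclideanSpace ℝ (Fin (n + 1))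

/-- The unit sphere `S^{N-1} ⊂ ℝ^N`, where `N = n + 1`. -/
abbrev Sph (n : ℕ) : Type := Metric.sphere (0 : Amb n) 1

/-- The surface measure `𝓗^{N-1}` on `S^{N-1}`. -/
abbrev surf (n : ℕ) : Measure (Sph n) := (volume : Measure (Amb n)).toSphere

/-- The intrinsic (great-circle) distance on `S^{N-1}`. -/
def geoDist {n : ℕ} (x y : Sph n) : ℝ :=
  InnerProductGeometry.angle (x : Amb n) (y : Amb n)

/-- The open geodesic ball of centre `c` and radius `r`. -/
def geoBall {n : ℕ} (c : Sph n) (r : ℝ) : Set (Sph n) :=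
  {x | geoDist x c < r}

/-- The (extended) Hausdorff distance of two subsets of `S^{N-1}`, with respect to the intrinsic
distance of the sphere:
`max (sup_{x ∈ X} inf_{y ∈ Y} d(x, y)) (sup_{y ∈ Y} inf_{x ∈ X} d(x, y))`. -/
def geoHausdorff {n : ℕ} (X Y : Set (Sph n)) : ℝ≥0∞ :=
  (⨆ x ∈ X, ⨅ y ∈ Y, ENNReal.ofReal (geoDist x y)) ⊔
    (⨆ y ∈ Y, ⨅ x ∈ X, ENNReal.ofReal (geoDist x y))

/-- The spherical cap `S_+(η) = {ξ ∈ S^{N-1} : ξ_N > η}`. -/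
def sphericalCap (n : ℕ) (η : ℝ) : Set (Sph n) :=
  {ξ | η < (ξ : Amb n) (Fin.last n)}

/-- The uniform `C^{1,1}` class `Π_+(η, r)`: open sets that are compactly contained in `S_+(η)`
(closed subsets of the sphere are compact) and have, at every boundary point, an interior and an
exterior touching ball of radius `r`. -/
def uniformClass (n : ℕ) (η r : ℝ) : Set (Set (Sph n)) :=
  {A | IsOpen A ∧ closure A ⊆ sphericalCap n η ∧
    ∀ x ∈ frontier A, ∃ p q : Sph n,
      geoBall p r ⊆ A ∧ geoBall q r ⊆ Aᶜ ∧
      x ∈ frontier (geoBall p r) ∧ x ∈ frontier (geoBall q r)}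

/-- The extension of `u : S^{N-1} → ℝ` to `ℝ^N \ {0}` that is constant along rays from the origin
(with the irrelevant value `0` at the origin). -/
def radialExt {n : ℕ} (u : Sph n → ℝ) (y : Amb n) : ℝ :=
  if hy : y = 0 then 0
  else u ⟨‖y‖⁻¹ • y, by
    rw [mem_sphere_zero_iff_norm, norm_smul, norm_inv, norm_norm,
      inv_mul_cancel₀ (norm_ne_zero_iff.mpr hy)]⟩

/-- The gradient of `u` on the round sphere, as a vector of `ℝ^N` tangent to the sphere: the
Euclidean gradient of the extension of `u` that is constant along rays. -/
def sphGrad {n : ℕ} (u : Sph n → ℝ) (x : Sph n) : Amb n :=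
  gradient (radialExt u) (x : Amb n)

/-- The Sobolev space `W^{1,2}(A)`: the completion of the space of smooth functions on `A` with
finite norm `(‖u‖_{L²(A)}² + ‖∇u‖_{L²(A)}²)^{1/2}`. It is realised as the closure of
`{(u, ∇u) : u smooth on A, u ∈ L²(A), ∇u ∈ L²(A)}` in `L²(A) × L²(A; ℝ^N)`, so that a member is a
pair consisting of a Sobolev function and its gradient. (The product norm is equivalent to the
Sobolev norm, hence the closure is the same.) -/
def W12 {n : ℕ} (A : Set (Sph n)) :
    Set (Lp ℝ 2 ((surf n).restrict A) × Lp (Amb n) 2 ((surf n).restrict A)) :=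
  closure {p | ∃ u : Sph n → ℝ, ContMDiffOn (𝓡 n) 𝓘(ℝ, ℝ) ∞ u A ∧
    p.1 =ᵐ[(surf n).restrict A] u ∧ p.2 =ᵐ[(surf n).restrict A] sphGrad u}

/-- The square root of the first non-zero Neumann eigenvalue, by its variational formula
`μ₁(A) = inf {‖∇u‖_{L²(A)} / ‖u‖_{L²(A)} : u ∈ W^{1,2}(A), ∫_A u = 0, u ≢ 0}`. -/
def mu1 {n : ℕ} (A : Set (Sph n)) : ℝ :=
  sInf {t : ℝ | ∃ p ∈ W12 A, (∫ x in A, p.1 x ∂(surf n)) = 0 ∧ p.1 ≠ 0 ∧ t = ‖p.2‖ / ‖p.1‖}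

end AlmostConvexCones

end

noncomputable section

namespace AlmostConvexCones

open Set Metric Filter Topology
open scoped RealInnerProductSpace NNReal Pointwise

variable {n : ℕ}

/-! ### Radial projection onto the sphere -/

/-! The theorem holds because one smooth map, close to the identity, moves `A` and `A'` into each
other, so that a near-minimiser on `A` can be transplanted to `A'`. No extension operator and no
compact embedding is needed.

Two-sided touching balls of radius `r` give each boundary point a normal along which the set is
pinched between two paraboloids of uniform curvature `κ` (`exists_hasNormals`). Nearby normals are
nearly parallel, so freezing them on a fixed finite net and gluing with fixed bumps gives a smooth
field `X`, with bounds uniform over the class, that points into `A` (`exists_isTransverse`). Put `Φ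
= push X t`. Then `Φ` maps `A` into itself with margin `t / 16`. If the boundaries are close, `A`
and `A'` agree away from `∂A`: agreement propagates over the connected sphere from the south pole,
which lies in neither set (`mem_iff_mem_of_frontierNear`). Hence `Φ` maps `A'` into `A` and `A` into
`A'` (`exists_pushing_fields`).

As `t → 0`, `Φ` distorts measures and gradients by a factor `J → 1`, and moves a function in `L²` by
`O(t)` times the norm of its gradient. For `u` nearly optimal on `A`, test `u ∘ Φ` on `A'`. The
gradient norm grows at most by `J²`. Since `Φ(A')` contains `Φ²(A)`, the `L²` mass that can be lost
sits in the layer `A \ Φ²(A)`. The images of this layer under `Φ^{2j}`, `j < m²`, are disjoint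
subsets of `A`, so one of them carries at most the fraction `1/m` of the norm; comparing the layer
with that image costs only the displacement (`IsQuasiIsometry.eLpNorm_layer_le`). This gives `mu1 A'
* (1 - 4 / m) ≤ J ^ 3 * mu1 A` (`IsQuasiIsometry.mu1_mul_le`).

Every non-empty member of the class contains a ball of fixed size, so `mu1` is bounded uniformly
(`exists_bound_mu1`). Choosing `m`, then `J`, then `t` bounds `mu1 A' - mu1 A`, and symmetry
finishes. -/

theorem norm_coe (x : Sph n) : ‖(x : Amb n)‖ = 1 := norm_eq_of_mem_sphere x

theorem coe_ne_zero (x : Sph n) : (x : Amb n) ≠ 0 := ne_zero_of_mem_unit_sphere x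

/-- The radial projection of `ℝ^N` onto the sphere (with an irrelevant value at the origin). -/
def proj (v : Amb n) : Sph n :=
  -- The default value is the south pole; `proj 0` later serves as a point outside every member of
  -- the class.
  if hv : v = 0 then ⟨EuclideanSpace.single (Fin.last n) (-1), by simp⟩
  else ⟨‖v‖⁻¹ • v, by
    rw [mem_sphere_zero_iff_norm, norm_smul, norm_inv, norm_norm,
      inv_mul_cancel₀ (norm_ne_zero_iff.mpr hv)]⟩

theorem coe_proj {v : Amb n} (hv : v ≠ 0) : (proj v : Amb n) = ‖v‖⁻¹ • v := by
  simp [proj, hv]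

theorem norm_smul_proj (v : Amb n) : ‖v‖ • (proj v : Amb n) = v := by
  by_cases hv : v = 0
  · simp [hv]
  · rw [coe_proj hv, smul_smul, mul_inv_cancel₀ (norm_ne_zero_iff.mpr hv), one_smul]

theorem proj_coe (x : Sph n) : proj (x : Amb n) = x := by
  apply Subtype.ext
  rw [coe_proj (coe_ne_zero x), norm_coe, inv_one, one_smul]

theorem proj_smul {c : ℝ} (hc : 0 < c) {v : Amb n} (hv : v ≠ 0) : proj (c • v) = proj v := by
  apply Subtype.ext
  rw [coe_proj (smul_ne_zero hc.ne' hv), coe_proj hv, norm_smul, smul_smul, Real.norm_eq_abs,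
    abs_of_pos hc]
  congr 1
  field_simp

theorem proj_smul_coe {c : ℝ} (hc : 0 < c) (x : Sph n) : proj (c • (x : Amb n)) = x := by
  rw [proj_smul hc (coe_ne_zero x), proj_coe]

theorem radialExt_eq (u : Sph n → ℝ) {y : Amb n} (hy : y ≠ 0) : radialExt u y = u (proj y) := by
  simp [radialExt, proj, hy]

theorem inner_proj (v w : Amb n) (hv : v ≠ 0) : ⟪(proj v : Amb n), w⟫ = ‖v‖⁻¹ * ⟪v, w⟫ := by
  rw [coe_proj hv, real_inner_smul_left]

theorem abs_norm_sub_one_le (v : Amb n) (y : Sph n) : |‖v‖ - 1| ≤ ‖v - y‖ := by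
  have := abs_norm_sub_norm_le v (y : Amb n)
  rwa [norm_coe] at this

theorem norm_proj_sub_self_le (v : Amb n) (y : Sph n) : ‖(proj v : Amb n) - v‖ ≤ ‖v - y‖ := by
  have h : (proj v : Amb n) - v = (1 - ‖v‖) • (proj v : Amb n) := by
    rw [sub_smul, norm_smul_proj, one_smul]
  rw [h, norm_smul, norm_coe, mul_one, Real.norm_eq_abs, abs_sub_comm]
  exact abs_norm_sub_one_le v y

theorem norm_proj_sub_le (v : Amb n) (y : Sph n) : ‖(proj v : Amb n) - y‖ ≤ 2 * ‖v - y‖ := by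
  have h1 := norm_proj_sub_self_le v y
  have h2 : (proj v : Amb n) - y = ((proj v : Amb n) - v) + (v - y) := by abel
  rw [h2]
  linarith [norm_add_le ((proj v : Amb n) - v) (v - y)]

theorem add_ne_zero_of_norm_lt {y : Sph n} {w : Amb n} (hw : ‖w‖ < 1) : (y : Amb n) + w ≠ 0 := by
  intro h
  have : (y : Amb n) = -w := by rw [eq_neg_iff_add_eq_zero, h]
  have h2 := norm_coe y
  rw [this, norm_neg] at h2
  linarith

theorem contMDiffAt_proj {v : Amb n} (hv : v ≠ 0) :
    ContMDiffAt 𝓘(ℝ, Amb n) (𝓡 n) ∞ (proj (n := n)) v := by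
  have : Fact (Module.finrank ℝ (Amb n) = n + 1) := ⟨finrank_euclideanSpace_fin⟩
  let U : TopologicalSpace.Opens (Amb n) := ⟨{0}ᶜ, isOpen_compl_singleton⟩
  have h1 : ContMDiff 𝓘(ℝ, Amb n) 𝓘(ℝ, Amb n) ∞ (fun y : U => ‖(y : Amb n)‖⁻¹ • (y : Amb n)) := by
    intro y
    have hy : (y : Amb n) ≠ 0 := y.2
    rw [contMDiffAt_subtype_iff (f := fun y : Amb n => ‖y‖⁻¹ • y), contMDiffAt_iff_contDiffAt]
    exact ((contDiffAt_id.norm ℝ hy).inv (norm_ne_zero_iff.2 hy)).smul contDiffAt_id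
  have h2 : ∀ y : U, ‖(y : Amb n)‖⁻¹ • (y : Amb n) ∈ sphere (0 : Amb n) 1 := by
    intro y
    have := (proj (y : Amb n)).2
    rwa [coe_proj (show (y : Amb n) ≠ 0 from y.2)] at this
  have h3 := ContMDiff.codRestrict_sphere (n := n) h1 h2
  have h4 : (Set.codRestrict _ _ h2 : U → Sph n) = fun y : U => proj (y : Amb n) := by
    funext y
    apply Subtype.ext
    rw [coe_proj (show (y : Amb n) ≠ 0 from y.2)]
    rfl
  rw [h4] at h3
  exact contMDiffAt_subtype_iff.1 (h3 ⟨v, hv⟩)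

theorem continuousAt_proj {v : Amb n} (hv : v ≠ 0) : ContinuousAt (proj (n := n)) v :=
  (contMDiffAt_proj hv).continuousAt

/-! ### Boundary crossing -/

theorem mem_iff_mem_of_isPreconnected {X : Type*} [TopologicalSpace X] {s A : Set X}
    (hs : IsPreconnected s) (h : ∀ y ∈ s, y ∉ frontier A) {a z : X} (ha : a ∈ s) (hz : z ∈ s) :
    a ∈ A ↔ z ∈ A := by
  have hsub : s ⊆ interior A ∪ (closure A)ᶜ := by
    intro y hy
    by_cases hyc : y ∈ closure A
    · left
      by_contra hi
      exact h y hy ⟨hyc, hi⟩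
    · right
      exact hyc
  have hd : Disjoint (interior A) (closure A)ᶜ :=
    disjoint_compl_right_iff_subset.2 (interior_subset.trans subset_closure)
  rcases hs.subset_or_subset isOpen_interior isClosed_closure.isOpen_compl hd hsub with h1 | h1
  · exact iff_of_true (interior_subset (h1 ha)) (interior_subset (h1 hz))
  · exact iff_of_false (fun h2 => h1 ha (subset_closure h2)) (fun h2 => h1 hz (subset_closure h2))

/-- The chord from `a` to `z` avoids the origin, so its radial projection is a path on the sphere
and must cross the boundary; the factor 2 is the cost of projecting. -/
theorem exists_mem_frontier_near {A : Set (Sph n)} {a z : Sph n} (h : ¬(a ∈ A ↔ z ∈ A))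
    (haz : ‖(z : Amb n) - a‖ < 1) :
    ∃ y ∈ frontier A, ‖(y : Amb n) - a‖ ≤ 2 * ‖(z : Amb n) - a‖ := by
  set γ : ℝ → Sph n := fun s => proj ((a : Amb n) + s • ((z : Amb n) - a)) with hγ
  have hsm : ∀ s ∈ Icc (0 : ℝ) 1, ‖s • ((z : Amb n) - a)‖ ≤ ‖(z : Amb n) - a‖ := by
    intro s hs
    rw [norm_smul, Real.norm_eq_abs, abs_of_nonneg hs.1]
    exact mul_le_of_le_one_left (norm_nonneg _) hs.2
  have hc : ContinuousOn γ (Icc 0 1) := by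
    intro s hs
    apply ContinuousAt.continuousWithinAt
    have h0 := add_ne_zero_of_norm_lt (y := a) ((hsm s hs).trans_lt haz)
    exact ContinuousAt.comp (f := fun s : ℝ => (a : Amb n) + s • ((z : Amb n) - a))
      (continuousAt_proj h0) (by fun_prop)
  have hpre := isPreconnected_Icc.image γ hc
  have h0 : γ 0 = a := by simp [hγ, proj_coe]
  have h1 : γ 1 = z := by simp [hγ, proj_coe]
  have ha : a ∈ γ '' Icc 0 1 := ⟨0, by simp, h0⟩
  have hz : z ∈ γ '' Icc 0 1 := ⟨1, by simp, h1⟩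
  have : ∃ y ∈ γ '' Icc 0 1, y ∈ frontier A := by
    by_contra! hcon
    exact h (mem_iff_mem_of_isPreconnected hpre hcon ha hz)
  obtain ⟨y, ⟨s, hs, rfl⟩, hy⟩ := this
  refine ⟨_, hy, (norm_proj_sub_le _ a).trans ?_⟩
  rw [add_sub_cancel_left]
  exact mul_le_mul_of_nonneg_left (hsm s hs) (by norm_num)

/-! ### Normals -/

/-- `ν` is an inner unit normal of `A` at `y`, with touching balls of curvature controlled by `κ`
on both sides. -/
def IsNormal (κ : ℝ) (A : Set (Sph n)) (y : Sph n) (ν : Amb n) : Prop :=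
  ‖ν‖ = 1 ∧ ⟪(y : Amb n), ν⟫ = 0 ∧ ∀ z : Sph n,
    (κ * ‖(z : Amb n) - y‖ ^ 2 < ⟪(z : Amb n), ν⟫ → z ∈ A) ∧
    (⟪(z : Amb n), ν⟫ < -(κ * ‖(z : Amb n) - y‖ ^ 2) → z ∉ A)

/-- Every boundary point of `A` has a normal in the sense of `IsNormal κ`. -/
def HasNormals (κ : ℝ) (A : Set (Sph n)) : Prop :=
  IsOpen A ∧ ∀ y ∈ frontier A, ∃ ν, IsNormal κ A y ν

theorem inner_coe_coe (z y : Sph n) :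
    ⟪(z : Amb n), (y : Amb n)⟫ = 1 - ‖(z : Amb n) - y‖ ^ 2 / 2 := by
  have := norm_sub_sq_real (z : Amb n) y
  rw [norm_coe, norm_coe] at this
  linarith

theorem cos_geoDist (x y : Sph n) : Real.cos (geoDist x y) = ⟪(x : Amb n), (y : Amb n)⟫ := by
  rw [geoDist, InnerProductGeometry.cos_angle, norm_coe, norm_coe, mul_one, div_one]

theorem continuous_geoDist (c : Sph n) : Continuous fun x : Sph n => geoDist x c := by
  unfold geoDist InnerProductGeometry.angle
  simp only [norm_coe]
  fun_prop

theorem geoDist_nonneg (x y : Sph n) : 0 ≤ geoDist x y := InnerProductGeometry.angle_nonneg _ _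

theorem geoDist_le_pi (x y : Sph n) : geoDist x y ≤ Real.pi := InnerProductGeometry.angle_le_pi _ _

theorem geoDist_self (x : Sph n) : geoDist x x = 0 :=
  InnerProductGeometry.angle_self (coe_ne_zero x)

theorem geoDist_of_mem_frontier {p x : Sph n} {r : ℝ} (hx : x ∈ frontier (geoBall p r)) :
    geoDist x p = r := by
  have ho : IsOpen (geoBall p r) := isOpen_lt (continuous_geoDist p) continuous_const
  rw [ho.frontier_eq] at hx
  apply le_antisymm
  · have hc : IsClosed {x : Sph n | geoDist x p ≤ r} :=
      isClosed_le (continuous_geoDist p) continuous_const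
    exact closure_minimal (fun z (hz : geoDist z p < r) => hz.le) hc hx.1
  · exact not_lt.1 hx.2

/-- The unit tangent vector at `x` pointing to the point `p` at distance `r`. -/
def direction (r : ℝ) (p x : Sph n) : Amb n :=
  (Real.sin r)⁻¹ • ((p : Amb n) - Real.cos r • (x : Amb n))

theorem inner_direction {r : ℝ} (hs : 0 < Real.sin r) {p x : Sph n} (z : Sph n) :
    Real.sin r * ⟪(z : Amb n), direction r p x⟫ =
      ⟪(z : Amb n), (p : Amb n)⟫ - Real.cos r * ⟪(z : Amb n), (x : Amb n)⟫ := by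
  rw [direction, real_inner_smul_right, inner_sub_right, real_inner_smul_right]
  field_simp

theorem inner_self_direction {r : ℝ} (hs : 0 < Real.sin r) {p x : Sph n} (h : geoDist x p = r) :
    ⟪(x : Amb n), direction r p x⟫ = 0 := by
  have := inner_direction hs (p := p) (x := x) x
  rw [← cos_geoDist, h, real_inner_self_eq_norm_sq, norm_coe] at this
  have h2 : Real.sin r * ⟪(x : Amb n), direction r p x⟫ = 0 := by rw [this]; ring
  exact (mul_eq_zero.1 h2).resolve_left hs.ne'

theorem norm_direction {r : ℝ} (hs : 0 < Real.sin r) {p x : Sph n} (h : geoDist x p = r) :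
    ‖direction r p x‖ = 1 := by
  have h1 : ‖(p : Amb n) - Real.cos r • (x : Amb n)‖ ^ 2 = Real.sin r ^ 2 := by
    rw [norm_sub_sq_real, real_inner_smul_right, norm_smul, norm_coe, norm_coe, real_inner_comm,
      ← cos_geoDist, h, Real.sin_sq, Real.norm_eq_abs, mul_one, sq_abs]
    ring
  have h2 : ‖(p : Amb n) - Real.cos r • (x : Amb n)‖ = Real.sin r :=
    (pow_left_inj₀ (norm_nonneg _) hs.le two_ne_zero).1 h1
  rw [direction, norm_smul, h2, norm_inv, Real.norm_eq_abs, abs_of_pos hs, inv_mul_cancel₀ hs.ne']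

/-- With `q = ‖z - x‖²`, the hypothesis says `⟪z, p⟫ > q + cos r * (1 - q / 2)`, and the right side
is at least `cos r`. -/
theorem mem_geoBall_of_inner_direction {r : ℝ} (hr0 : 0 ≤ r)
    (hs : 0 < Real.sin r) {p x z : Sph n}
    (hz : (Real.sin r)⁻¹ * ‖(z : Amb n) - x‖ ^ 2 < ⟪(z : Amb n), direction r p x⟫) :
    z ∈ geoBall p r := by
  have h1 := inner_direction hs (p := p) (x := x) z
  have h2 : ‖(z : Amb n) - x‖ ^ 2 < Real.sin r * ⟪(z : Amb n), direction r p x⟫ := by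
    calc _ = Real.sin r * ((Real.sin r)⁻¹ * ‖(z : Amb n) - x‖ ^ 2) := by field_simp
      _ < _ := mul_lt_mul_of_pos_left hz hs
  rw [h1, inner_coe_coe z x, ← cos_geoDist] at h2
  have h3 : Real.cos r < Real.cos (geoDist z p) := by
    have := Real.neg_one_le_cos r
    nlinarith [sq_nonneg ‖(z : Amb n) - x‖, Real.cos_le_one r]
  by_contra hcon
  have hcon' : r ≤ geoDist z p := not_lt.1 hcon
  exact absurd (Real.cos_le_cos_of_nonneg_of_le_pi hr0 (geoDist_le_pi z p) hcon') (not_le.2 h3)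

/-- Two half-space type conditions at a common point are compatible unless the directions are
opposite. -/
theorem exists_inner_gt_of_ne_neg {κ : ℝ} (hκ : 0 ≤ κ) {x : Sph n} {ν ν' : Amb n} (h1 : ‖ν‖ = 1)
    (h1' : ‖ν'‖ = 1) (hx : ⟪(x : Amb n), ν⟫ = 0) (hx' : ⟪(x : Amb n), ν'⟫ = 0) (hne : ν' ≠ -ν) :
    ∃ z : Sph n, κ * ‖(z : Amb n) - x‖ ^ 2 < ⟪(z : Amb n), ν⟫ ∧
      κ * ‖(z : Amb n) - x‖ ^ 2 < ⟪(z : Amb n), ν'⟫ := by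
  set c := ⟪ν, ν'⟫ with hc
  set w := ν + ν' with hw
  have hwsq : ‖w‖ ^ 2 = 2 * (1 + c) := by
    rw [hw, norm_add_sq_real, h1, h1']; ring
  have hwne : w ≠ 0 := fun h => hne (by rw [eq_neg_iff_add_eq_zero, add_comm]; exact h)
  have hpos : 0 < 1 + c := by
    have : 0 < ‖w‖ ^ 2 := by positivity
    linarith
  have hw2 : ‖w‖ ≤ 2 := (norm_add_le _ _).trans (by linarith)
  -- A step `s • w` raises both heights by `s * (1 + c)`, while the quadratic term is at most `8 * κ
  -- * s` times that; this `s` makes `8 * κ * s < 1 / 2`.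
  set s : ℝ := 1 / (16 * (κ + 1)) with hsdef
  have hs : 0 < s := by positivity
  have hs1 : s * (16 * (κ + 1)) = 1 := by rw [hsdef]; field_simp
  have hs2 : s ≤ 1 / 16 := by nlinarith
  have hsw : ‖s • w‖ ≤ 2 * s := by
    rw [norm_smul, Real.norm_eq_abs, abs_of_pos hs]; nlinarith
  have hv0 := add_ne_zero_of_norm_lt (y := x) (w := s • w) (by linarith)
  have hvn : ‖(x : Amb n) + s • w‖ ≤ 9 / 8 := by
    have := norm_add_le (x : Amb n) (s • w)
    rw [norm_coe] at this; linarith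
  have hvp : 0 < ‖(x : Amb n) + s • w‖ := norm_pos_iff.2 hv0
  have hinv : 8 / 9 ≤ ‖(x : Amb n) + s • w‖⁻¹ := by
    rw [le_inv_comm₀ (by norm_num) hvp]; linarith
  have hd := norm_proj_sub_le ((x : Amb n) + s • w) x
  rw [add_sub_cancel_left] at hd
  have hd2 : ‖(proj ((x : Amb n) + s • w) : Amb n) - x‖ ^ 2 ≤ 4 * (s ^ 2 * (2 * (1 + c))) := by
    calc _ ≤ (2 * ‖s • w‖) ^ 2 := by gcongr
      _ = _ := by
        rw [norm_smul, Real.norm_eq_abs, abs_of_pos hs, ← hwsq]; ring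
  have key : κ * ‖(proj ((x : Amb n) + s • w) : Amb n) - x‖ ^ 2 <
      ‖(x : Amb n) + s • w‖⁻¹ * (s * (1 + c)) := by
    calc _ ≤ κ * (4 * (s ^ 2 * (2 * (1 + c)))) := by gcongr
      _ = (8 * κ * s) * (s * (1 + c)) := by ring
      _ < 8 / 9 * (s * (1 + c)) := by
        apply mul_lt_mul_of_pos_right _ (by positivity)
        nlinarith
      _ ≤ _ := by gcongr
  refine ⟨proj ((x : Amb n) + s • w), ?_, ?_⟩
  · rw [inner_proj _ _ hv0, inner_add_left, hx, real_inner_smul_left, hw, inner_add_left,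
      real_inner_self_eq_norm_sq, h1, real_inner_comm, ← hc]
    convert key using 2
    ring
  · rw [inner_proj _ _ hv0, inner_add_left, hx', real_inner_smul_left, hw, inner_add_left,
      real_inner_self_eq_norm_sq, h1', ← hc]
    convert key using 2
    ring

/-- The inner and the outer touching ball are disjoint, so by `exists_inner_gt_of_ne_neg` their
directions at `x` are opposite, and a single `ν` describes both. -/
theorem exists_hasNormals (n : ℕ) (η : ℝ) {r : ℝ} (hr : 0 < r) :
    ∃ κ : ℝ, 1 ≤ κ ∧ ∀ A ∈ uniformClass n η r, HasNormals κ A := by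
  refine ⟨max 1 (Real.sin r)⁻¹, le_max_left _ _, ?_⟩
  rintro A ⟨hA, -, hball⟩
  refine ⟨hA, fun x hx => ?_⟩
  obtain ⟨p, q, hp, hq, hxp, hxq⟩ := hball x hx
  have hdp := geoDist_of_mem_frontier hxp
  have hdq := geoDist_of_mem_frontier hxq
  -- At distance `π` both centres would be the antipode of `x`, and the two balls would share it.
  have hrp : r < Real.pi := by
    rcases (geoDist_le_pi x p).lt_or_eq with h | h
    · rwa [hdp] at h
    · exfalso
      have h2 : geoDist x q = Real.pi := by rw [hdq, ← hdp, h]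
      have e1 := InnerProductGeometry.angle_eq_pi_iff.1 h
      have e2 := InnerProductGeometry.angle_eq_pi_iff.1 h2
      have f1 : (p : Amb n) = -x := by
        have := cos_geoDist x p
        rw [h, Real.cos_pi] at this
        have h3 : ‖(x : Amb n) + p‖ ^ 2 = 0 := by
          rw [norm_add_sq_real, ← this, norm_coe, norm_coe]; norm_num
        have h4 : (x : Amb n) + p = 0 := by simpa using h3
        rw [eq_neg_iff_add_eq_zero, add_comm]; exact h4
      have f2 : (q : Amb n) = -x := by
        have := cos_geoDist x q
        rw [h2, Real.cos_pi] at this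
        have h3 : ‖(x : Amb n) + q‖ ^ 2 = 0 := by
          rw [norm_add_sq_real, ← this, norm_coe, norm_coe]; norm_num
        have h4 : (x : Amb n) + q = 0 := by simpa using h3
        rw [eq_neg_iff_add_eq_zero, add_comm]; exact h4
      have f3 : p = q := Subtype.ext (f1.trans f2.symm)
      have hpp : p ∈ geoBall p r := by
        change geoDist p p < r
        rwa [geoDist_self]
      exact hq (f3 ▸ hpp) (hp hpp)
  have hs := Real.sin_pos_of_pos_of_lt_pi hr hrp
  have hp' : ∀ z : Sph n, max 1 (Real.sin r)⁻¹ * ‖(z : Amb n) - x‖ ^ 2 <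
      ⟪(z : Amb n), direction r p x⟫ → z ∈ geoBall p r := fun z hz =>
    mem_geoBall_of_inner_direction hr.le hs (lt_of_le_of_lt (by gcongr; exact le_max_right _ _) hz)
  have hq' : ∀ z : Sph n, max 1 (Real.sin r)⁻¹ * ‖(z : Amb n) - x‖ ^ 2 <
      ⟪(z : Amb n), direction r q x⟫ → z ∈ geoBall q r := fun z hz =>
    mem_geoBall_of_inner_direction hr.le hs (lt_of_le_of_lt (by gcongr; exact le_max_right _ _) hz)
  have hopp : direction r q x = -direction r p x := by
    by_contra hne
    obtain ⟨z, hz1, hz2⟩ := exists_inner_gt_of_ne_neg (κ := max 1 (Real.sin r)⁻¹)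
      (by positivity) (norm_direction hs hdp) (norm_direction hs hdq)
      (inner_self_direction hs hdp) (inner_self_direction hs hdq) hne
    exact hq (hq' z hz2) (hp (hp' z hz1))
  refine ⟨direction r p x, norm_direction hs hdp, inner_self_direction hs hdp, fun z => ⟨fun hz => hp (hp' z hz), fun hz => hq (hq' z ?_)⟩⟩
  rw [hopp, inner_neg_right]
  linarith

theorem IsNormal.inner_le_of_notMem {κ : ℝ} {A : Set (Sph n)} {y : Sph n} {ν : Amb n}
    (h : IsNormal κ A y ν) {z : Sph n} (hz : z ∉ A) :
    ⟪(z : Amb n), ν⟫ ≤ κ * ‖(z : Amb n) - y‖ ^ 2 :=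
  not_lt.1 fun h1 => hz ((h.2.2 z).1 h1)

theorem IsNormal.le_inner_of_mem {κ : ℝ} {A : Set (Sph n)} {y : Sph n} {ν : Amb n}
    (h : IsNormal κ A y ν) {z : Sph n} (hz : z ∈ A) :
    -(κ * ‖(z : Amb n) - y‖ ^ 2) ≤ ⟪(z : Amb n), ν⟫ :=
  not_lt.1 fun h1 => (h.2.2 z).2 h1 hz

theorem IsNormal.abs_inner_le_of_mem_frontier {κ : ℝ} {A : Set (Sph n)} (hA : IsOpen A)
    {y : Sph n} {ν : Amb n} (h : IsNormal κ A y ν) {z : Sph n} (hz : z ∈ frontier A) :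
    |⟪(z : Amb n), ν⟫| ≤ κ * ‖(z : Amb n) - y‖ ^ 2 := by
  rw [hA.frontier_eq] at hz
  refine abs_le.2 ⟨?_, h.inner_le_of_notMem hz.2⟩
  have hc : IsClosed {z : Sph n | -(κ * ‖(z : Amb n) - y‖ ^ 2) ≤ ⟪(z : Amb n), ν⟫} :=
    isClosed_le (by fun_prop) (by fun_prop)
  exact closure_minimal (fun z hz => h.le_inner_of_mem hz) hc hz.1

theorem abs_inner_le_norm_of_norm_one {ν : Amb n} (h : ‖ν‖ = 1) (v : Amb n) : |⟪v, ν⟫| ≤ ‖v‖ := by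
  have := abs_real_inner_le_norm v ν
  rwa [h, mul_one] at this

/-- If the normals differed much, a step from `y` along `ν - ν'` would climb with respect to `ν` and
descend with respect to `ν'`, ending both inside and outside `A`. -/
theorem IsNormal.inner_ge_of_near {κ : ℝ} (hκ : 1 ≤ κ) {A : Set (Sph n)} {y y' : Sph n}
    {ν ν' : Amb n} (h : IsNormal κ A y ν) (h' : IsNormal κ A y' ν')
    (hd : ‖(y : Amb n) - y'‖ ≤ 1 / (1000 * κ)) : 3 / 4 ≤ ⟪ν, ν'⟫ := by
  by_contra! hlt
  set c := ⟪ν, ν'⟫ with hc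
  set w := ν - ν' with hw
  set ρ : ℝ := 1 / (1000 * κ) with hρ
  have hκ0 : 0 < κ := by linarith
  have hρ0 : 0 < ρ := by positivity
  have hρκ : κ * ρ = 1 / 1000 := by rw [hρ]; field_simp
  have hwsq : ‖w‖ ^ 2 = 2 * (1 - c) := by
    rw [hw, norm_sub_sq_real, h.1, h'.1]; ring
  have hw2 : ‖w‖ ≤ 2 := (norm_sub_le _ _).trans (by rw [h.1, h'.1]; norm_num)
  have hw1 : 1 / 2 ≤ ‖w‖ := by
    by_contra! h3
    nlinarith [norm_nonneg w]
  -- Long enough to dominate the offset `ρ` between `y` and `y'`, short enough that `κ * s` is small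
  -- and the quadratic terms lose.
  set s : ℝ := 16 * ρ with hs
  have hs0 : 0 < s := by positivity
  have hsκ : κ * s = 16 / 1000 := by rw [hs]; linarith
  have hs1 : s ≤ 16 / 1000 := by nlinarith
  have hsw : ‖s • w‖ = s * ‖w‖ := by rw [norm_smul, Real.norm_eq_abs, abs_of_pos hs0]
  have hsw2 : ‖s • w‖ ≤ 2 * s := by rw [hsw]; nlinarith
  have hv0 := add_ne_zero_of_norm_lt (y := y) (w := s • w) (by linarith)
  set v := (y : Amb n) + s • w with hv
  have hvp : 0 < ‖v‖ := norm_pos_iff.2 hv0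
  have hvn : ‖v‖ ≤ 2 := by
    have := norm_add_le (y : Amb n) (s • w)
    rw [norm_coe] at this; linarith
  have hinv : 1 / 2 ≤ ‖v‖⁻¹ := by
    rw [le_inv_comm₀ (by norm_num) hvp]; linarith
  have hd1 := norm_proj_sub_le v y
  rw [hv, add_sub_cancel_left, ← hv, hsw] at hd1
  have hc1 : 1 / 4 < 1 - c := by linarith
  have hP : 0 < s * (1 - c) := mul_pos hs0 (by linarith)
  have hin : proj v ∈ A := by
    apply (h.2.2 _).1
    rw [inner_proj _ _ hv0, hv, inner_add_left, h.2.1, real_inner_smul_left, hw, inner_sub_left,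
      real_inner_self_eq_norm_sq, h.1, real_inner_comm, ← hc, ← hw, ← hv]
    calc κ * ‖(proj v : Amb n) - y‖ ^ 2 ≤ κ * (2 * (s * ‖w‖)) ^ 2 := by gcongr
      _ = (κ * s) * 8 * (s * (1 - c)) := by
        rw [mul_pow, mul_pow, hwsq]; ring
      _ < 1 / 2 * (0 + s * (1 ^ 2 - c)) := by rw [hsκ]; linarith
      _ ≤ _ := by
        apply mul_le_mul_of_nonneg_right hinv
        linarith
  refine (h'.2.2 (proj v)).2 ?_ hin
  have hyν : ⟪(y : Amb n), ν'⟫ ≤ s / 16 := by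
    have h1 := (le_abs_self _).trans (abs_inner_le_norm_of_norm_one h'.1 ((y : Amb n) - y'))
    rw [inner_sub_left, h'.2.1] at h1
    linarith
  have hd2 : ‖(proj v : Amb n) - y'‖ ≤ (17 / 8) * (s * ‖w‖) := by
    have e : (proj v : Amb n) - y' = ((proj v : Amb n) - y) + ((y : Amb n) - y') := by abel
    rw [e]
    refine (norm_add_le _ _).trans ?_
    have : s * (1 / 2) ≤ s * ‖w‖ := by gcongr
    linarith
  rw [inner_proj _ _ hv0, hv, inner_add_left, real_inner_smul_left, hw, inner_sub_left,
    real_inner_self_eq_norm_sq, h'.1, ← hc, ← hw, ← hv]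
  have e1 : κ * ‖(proj v : Amb n) - y'‖ ^ 2 ≤ (16 / 1000) * (17 / 8) ^ 2 * 2 * (s * (1 - c)) := by
    calc _ ≤ κ * ((17 / 8) * (s * ‖w‖)) ^ 2 := by gcongr
      _ = (κ * s) * (17 / 8) ^ 2 * 2 * (s * (1 - c)) := by
        rw [mul_pow, mul_pow, hwsq]; ring
      _ = _ := by rw [hsκ]
  have e2 : ⟪(y : Amb n), ν'⟫ + s * (c - 1 ^ 2) ≤ -(3 / 4 * (s * (1 - c))) := by
    have : s * (1 / 4) ≤ s * (1 - c) := by gcongr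
    linarith
  have e3 : ‖v‖⁻¹ * (⟪(y : Amb n), ν'⟫ + s * (c - 1 ^ 2)) ≤ 1 / 2 * -(3 / 4 * (s * (1 - c))) := by
    calc _ ≤ ‖v‖⁻¹ * -(3 / 4 * (s * (1 - c))) := by gcongr
      _ ≤ _ := mul_le_mul_of_nonpos_right hinv (by linarith)
  linarith

/-! ### The transverse vector field -/

theorem exists_finset_net (n : ℕ) {ρ : ℝ} (hρ : 0 < ρ) :
    ∃ T : Finset (Sph n), ∀ x : Sph n, ∃ c ∈ T, ‖(x : Amb n) - c‖ < ρ := by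
  obtain ⟨t, -, ht⟩ := (isCompact_univ : IsCompact (univ : Set (Sph n))).elim_nhds_subcover
    (fun c => ball c ρ) (fun c _ => ball_mem_nhds c hρ)
  refine ⟨t, fun x => ?_⟩
  have := ht (mem_univ x)
  simp only [mem_iUnion, mem_ball, Subtype.dist_eq, dist_eq_norm] at this
  obtain ⟨c, hc, h⟩ := this
  exact ⟨c, hc, h⟩

/-- A smooth vector field that is uniformly transverse to the boundary of `A`. -/
structure IsTransverse (κ M τ : ℝ) (A : Set (Sph n)) (X : Amb n → Amb n) : Prop where
  contDiff : ContDiff ℝ ∞ X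
  norm_le : ∀ x, ‖X x‖ ≤ M
  norm_sub_le : ∀ x y, ‖X x - X y‖ ≤ M * ‖x - y‖
  inner_ge : ∀ y ∈ frontier A, ∀ ν, IsNormal κ A y ν → ∀ x : Sph n,
    ‖(x : Amb n) - y‖ ≤ τ → 3 / 4 ≤ ⟪X x, ν⟫

/-- The net and the bumps do not depend on `A`, only the frozen unit vectors do; hence the uniform
bounds. The bumps add up to at least 1 and every active vector makes a good angle with `ν`, so no
normalisation is needed. -/
theorem exists_isTransverse (n : ℕ) {κ : ℝ} (hκ : 1 ≤ κ) :
    ∃ M τ : ℝ, 1 ≤ M ∧ 0 < τ ∧ ∀ A : Set (Sph n), HasNormals κ A →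
      ∃ X, IsTransverse κ M τ A X := by
  classical
  -- Two boundary points within `3 * ρ` of one net point are `6 * ρ` apart, below the threshold `10
  -- * ρ` of `IsNormal.inner_ge_of_near`.
  set ρ : ℝ := 1 / (1000 * κ) / 10 with hρ
  have hκ0 : 0 < κ := by linarith
  have hρ0 : 0 < ρ := by positivity
  obtain ⟨T, hT⟩ := exists_finset_net n hρ0
  let χ : ∀ c : Sph n, ContDiffBump (c : Amb n) := fun c => ⟨ρ, 2 * ρ, hρ0, by linarith⟩
  have hlip : ∀ c : Sph n, ∃ K : ℝ, 0 ≤ K ∧ ∀ x y, |χ c x - χ c y| ≤ K * ‖x - y‖ := by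
    intro c
    obtain ⟨K, hK⟩ := ((χ c).contDiff (n := 1)).lipschitzWith_of_hasCompactSupport
      (χ c).hasCompactSupport (by norm_num)
    exact ⟨K, K.2, fun x y => by simpa [dist_eq_norm] using hK.dist_le_mul x y⟩
  choose K hK0 hK using hlip
  refine ⟨max 1 (max (T.card : ℝ) (∑ c ∈ T, K c)), ρ, le_max_left _ _, hρ0, fun A hA => ?_⟩
  have hv : ∀ c : Sph n, ∃ v : Amb n, ‖v‖ ≤ 1 ∧
      ((∃ y ∈ frontier A, ‖(y : Amb n) - c‖ ≤ 3 * ρ) →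
        ∃ y ∈ frontier A, ‖(y : Amb n) - c‖ ≤ 3 * ρ ∧ IsNormal κ A y v) := by
    intro c
    by_cases h : ∃ y ∈ frontier A, ‖(y : Amb n) - c‖ ≤ 3 * ρ
    · obtain ⟨y, hy, hyc⟩ := h
      obtain ⟨ν, hν⟩ := hA.2 y hy
      exact ⟨ν, hν.1.le, fun _ => ⟨y, hy, hyc, hν⟩⟩
    · exact ⟨0, by simp, fun h' => absurd h' h⟩
  choose v hv1 hv2 using hv
  refine ⟨fun x => ∑ c ∈ T, χ c x • v c, ?_, ?_, ?_, ?_⟩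
  · exact ContDiff.sum fun c _ => (χ c).contDiff.smul contDiff_const
  · intro x
    refine (norm_sum_le _ _).trans (le_trans ?_ ((le_max_left _ _).trans (le_max_right _ _)))
    calc _ ≤ ∑ c ∈ T, (1 : ℝ) := by
          refine Finset.sum_le_sum fun c _ => ?_
          rw [norm_smul, Real.norm_eq_abs, abs_of_nonneg (χ c).nonneg]
          exact mul_le_one₀ (χ c).le_one (norm_nonneg _) (hv1 c)
      _ = _ := by simp
  · intro x y
    rw [← Finset.sum_sub_distrib]
    refine (norm_sum_le _ _).trans ?_
    calc _ ≤ ∑ c ∈ T, K c * ‖x - y‖ := by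
          refine Finset.sum_le_sum fun c _ => ?_
          rw [← sub_smul, norm_smul, Real.norm_eq_abs]
          exact (mul_le_of_le_one_right (abs_nonneg _) (hv1 c)).trans (hK c x y)
      _ = (∑ c ∈ T, K c) * ‖x - y‖ := by rw [Finset.sum_mul]
      _ ≤ _ := by gcongr; exact (le_max_right _ _).trans (le_max_right _ _)
  · intro y hy ν hν x hxy
    have hterm : ∀ c ∈ T, χ c x * (3 / 4) ≤ ⟪χ c x • v c, ν⟫ := by
      intro c _
      rw [real_inner_smul_left]
      by_cases hx : χ c x = 0
      · simp [hx]
      · have hxc : ‖(x : Amb n) - c‖ < 2 * ρ := by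
          by_contra! h
          exact hx ((χ c).zero_of_le_dist (by rw [dist_eq_norm]; exact h))
        have hyc : ‖(y : Amb n) - c‖ ≤ 3 * ρ := by
          have e : (y : Amb n) - c = ((x : Amb n) - c) - ((x : Amb n) - y) := by abel
          rw [e]
          linarith [norm_sub_le ((x : Amb n) - c) ((x : Amb n) - y)]
        obtain ⟨y', hy', hyc', hν'⟩ := hv2 c ⟨y, hy, hyc⟩
        have : ‖(y' : Amb n) - y‖ ≤ 1 / (1000 * κ) := by
          have e : (y' : Amb n) - y = ((y' : Amb n) - c) - ((y : Amb n) - c) := by abel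
          rw [e]
          have e2 : 1 / (1000 * κ) = 10 * ρ := by rw [hρ]; ring
          linarith [norm_sub_le ((y' : Amb n) - c) ((y : Amb n) - c)]
        exact mul_le_mul_of_nonneg_left (hν'.inner_ge_of_near hκ hν this) (χ c).nonneg
    obtain ⟨c, hc, hcx⟩ := hT x
    have h1 : 1 ≤ ∑ c ∈ T, χ c x := by
      calc 1 = χ c x := ((χ c).one_of_mem_closedBall
              (by rw [mem_closedBall, dist_eq_norm]; exact hcx.le)).symm
        _ ≤ _ := Finset.single_le_sum (f := fun c => χ c (x : Amb n))
              (fun c _ => (χ c).nonneg) hc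
    rw [sum_inner]
    calc 3 / 4 ≤ (∑ c ∈ T, χ c x) * (3 / 4) := by linarith
      _ = ∑ c ∈ T, χ c x * (3 / 4) := by rw [Finset.sum_mul]
      _ ≤ _ := Finset.sum_le_sum hterm

/-! ### The push map -/

/-- The point `x` pushed along `X` for the time `t`. -/
def push (X : Amb n → Amb n) (t : ℝ) (x : Sph n) : Sph n := proj ((x : Amb n) + t • X x)

theorem norm_smul_le_of_le {M t : ℝ} {w : Amb n} (ht : 0 ≤ t) (h : ‖w‖ ≤ M) : ‖t • w‖ ≤ t * M := by
  rw [norm_smul, Real.norm_eq_abs, abs_of_nonneg ht]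
  gcongr

/-- If `z ∉ A`, the boundary is crossed at some `y` between `a` and `z`. Over the tangent plane at
`y`, the point `a` is at worst slightly low and the push gains about `3 * t / 4`, which even after
normalisation and the errors `t / 16` exceeds the height `O(κ * (t * M) ^ 2)` allowed outside `A`.
-/
theorem IsTransverse.mem_of_near_push {κ M τ : ℝ} (hκ : 1 ≤ κ) (hM : 1 ≤ M) {A : Set (Sph n)}
    {X : Amb n → Amb n} (hA : HasNormals κ A) (hX : IsTransverse κ M τ A X) {t : ℝ} (ht : 0 < t)
    (ht1 : 7 * M * t ≤ τ) (ht2 : 1000 * (κ * M ^ 2) * t ≤ 1) {a x z : Sph n} (ha : a ∈ A)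
    (hxa : ‖(x : Amb n) - a‖ ≤ t / 16) (hz : ‖(z : Amb n) - push X t x‖ ≤ t / 16) : z ∈ A := by
  by_contra hzA
  have hMM : M ≤ M ^ 2 := by nlinarith
  have hκM : M ≤ κ * M ^ 2 := by nlinarith
  have htM : t * M ≤ 1 / 1000 := by nlinarith
  have htt : t ≤ t * M := by nlinarith
  have hsX := norm_smul_le_of_le ht.le (hX.norm_le x)
  have hv0 := add_ne_zero_of_norm_lt (y := x) (w := t • X x) (by linarith)
  have hpx := norm_proj_sub_le ((x : Amb n) + t • X x) x
  rw [add_sub_cancel_left] at hpx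
  have hza : ‖(z : Amb n) - a‖ ≤ 3 * (t * M) := by
    have e : (z : Amb n) - a = ((z : Amb n) - push X t x) +
      (((push X t x : Sph n) : Amb n) - x) + ((x : Amb n) - a) := by abel
    rw [e]
    refine (norm_add₃_le).trans ?_
    have : ‖((push X t x : Sph n) : Amb n) - x‖ ≤ 2 * (t * M) := hpx.trans (by linarith)
    linarith
  obtain ⟨y, hy, hya⟩ := exists_mem_frontier_near (A := A) (a := a) (z := z)
    (fun h => hzA (h.1 ha)) (by linarith)
  obtain ⟨ν, hν⟩ := hA.2 y hy
  have hay : ‖(a : Amb n) - y‖ ≤ 6 * (t * M) := by rw [norm_sub_rev]; linarith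
  have hxy : ‖(x : Amb n) - y‖ ≤ 7 * (t * M) := by
    have e : (x : Amb n) - y = ((x : Amb n) - a) + ((a : Amb n) - y) := by abel
    rw [e]; linarith [norm_add_le ((x : Amb n) - a) ((a : Amb n) - y)]
  have hzy : ‖(z : Amb n) - y‖ ≤ 9 * (t * M) := by
    have e : (z : Amb n) - y = ((z : Amb n) - a) + ((a : Amb n) - y) := by abel
    rw [e]; linarith [norm_add_le ((z : Amb n) - a) ((a : Amb n) - y)]
  have h34 := hX.inner_ge y hy ν hν x (by linarith)
  have hz1 := hν.inner_le_of_notMem hzA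
  have ha1 := hν.le_inner_of_mem ha
  have hq : κ * (t * M) ^ 2 ≤ t / 1000 := by
    calc κ * (t * M) ^ 2 = t * (1000 * (κ * M ^ 2) * t) / 1000 := by ring
      _ ≤ t * 1 / 1000 := by gcongr
      _ = _ := by ring
  have hz2 : ⟪(z : Amb n), ν⟫ ≤ 81 * (t / 1000) := by
    calc _ ≤ κ * ‖(z : Amb n) - y‖ ^ 2 := hz1
      _ ≤ κ * (9 * (t * M)) ^ 2 := by gcongr
      _ = 81 * (κ * (t * M) ^ 2) := by ring
      _ ≤ _ := by gcongr
  have ha2 : -(36 * (t / 1000)) ≤ ⟪(a : Amb n), ν⟫ := by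
    have : κ * ‖(a : Amb n) - y‖ ^ 2 ≤ 36 * (t / 1000) := by
      calc _ ≤ κ * (6 * (t * M)) ^ 2 := by gcongr
        _ = 36 * (κ * (t * M) ^ 2) := by ring
        _ ≤ _ := by gcongr
    linarith
  have hx1 : ⟪(a : Amb n), ν⟫ - t / 16 ≤ ⟪(x : Amb n), ν⟫ := by
    have := (neg_abs_le _).trans' (neg_le_neg (abs_inner_le_norm_of_norm_one hν.1 ((x : Amb n) - a)))
    rw [inner_sub_left] at this
    linarith
  have hz3 : ⟪((push X t x : Sph n) : Amb n), ν⟫ - t / 16 ≤ ⟪(z : Amb n), ν⟫ := by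
    have := (neg_abs_le _).trans'
      (neg_le_neg (abs_inner_le_norm_of_norm_one hν.1 ((z : Amb n) - push X t x)))
    rw [inner_sub_left] at this
    linarith
  rw [push, inner_proj _ _ hv0, inner_add_left, real_inner_smul_left] at hz3
  have hvp : 0 < ‖(x : Amb n) + t • X x‖ := norm_pos_iff.2 hv0
  have hvn : ‖(x : Amb n) + t • X x‖ ≤ 2 := by
    have := norm_add_le (x : Amb n) (t • X x)
    rw [norm_coe] at this; linarith
  have hinv : 1 / 2 ≤ ‖(x : Amb n) + t • X x‖⁻¹ := by
    rw [le_inv_comm₀ (by norm_num) hvp]; linarith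
  have hnum : t / 2 ≤ ⟪(x : Amb n), ν⟫ + t * ⟪X x, ν⟫ := by nlinarith
  have : 1 / 2 * (t / 2) ≤ ‖(x : Amb n) + t • X x‖⁻¹ * (⟪(x : Amb n), ν⟫ + t * ⟪X x, ν⟫) := by
    gcongr
  linarith

/-! ### Domains with nearby boundaries -/

/-- Both conditions have the form `c * ‖w‖ < ⟪w, μ⟫` with `c ≥ 0`, so the set is the radial
projection of a convex cone. The bound on `R` makes `1 - R ^ 2 / 2` non-negative. -/
theorem isPreconnected_cap_inter {R d : ℝ} (hR : 0 ≤ R) (hR1 : R ≤ 1) (hd : 0 ≤ d) (y : Sph n)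
    (μ : Amb n) :
    IsPreconnected {z : Sph n | ‖(z : Amb n) - y‖ < R ∧ d < ⟪(z : Amb n), μ⟫} := by
  set C : Set (Amb n) := {w | (1 - R ^ 2 / 2) * ‖w‖ < ⟪w, (y : Amb n)⟫ ∧ d * ‖w‖ < ⟪w, μ⟫} with hC
  have hR2 : 0 ≤ 1 - R ^ 2 / 2 := by nlinarith
  have aux : ∀ (c : ℝ) (μ : Amb n), 0 ≤ c → Convex ℝ {w : Amb n | c * ‖w‖ < ⟪w, μ⟫} := by
    intro c μ hc
    have h1 : ConvexOn ℝ univ fun w : Amb n => c * ‖w‖ - ⟪w, μ⟫ := by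
      have e1 : ConvexOn ℝ univ fun w : Amb n => c • ‖w‖ := convexOn_univ_norm.smul hc
      have e2 : ConcaveOn ℝ univ fun w : Amb n => ⟪w, μ⟫ := by
        have := ((innerSL ℝ μ).toLinearMap).concaveOn (convex_univ (𝕜 := ℝ))
        simpa [real_inner_comm] using this
      exact e1.sub e2
    have e : {w : Amb n | c * ‖w‖ < ⟪w, μ⟫} = {w ∈ univ | c * ‖w‖ - ⟪w, μ⟫ < 0} := by
      ext w
      simp
    rw [e]
    exact h1.convex_lt 0
  have hconv : Convex ℝ C := (aux _ _ hR2).inter (aux _ _ hd)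
  have hne : ∀ w ∈ C, w ≠ 0 := by
    rintro w hw rfl
    simpa using hw.1
  have hlt : ∀ z : Sph n, ‖(z : Amb n) - y‖ < R ↔ 1 - R ^ 2 / 2 < ⟪(z : Amb n), (y : Amb n)⟫ := by
    intro z
    rw [inner_coe_coe]
    constructor
    · intro h
      have : ‖(z : Amb n) - y‖ ^ 2 < R ^ 2 := by gcongr
      linarith
    · intro h
      exact lt_of_pow_lt_pow_left₀ 2 hR (by linarith)
  have himg : {z : Sph n | ‖(z : Amb n) - y‖ < R ∧ d < ⟪(z : Amb n), μ⟫} = proj '' C := by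
    ext z
    simp only [mem_ofPred_eq, mem_image, hlt]
    constructor
    · intro h
      exact ⟨z, by simpa [hC, norm_coe] using h, proj_coe z⟩
    · rintro ⟨w, hw, rfl⟩
      have h0 := hne w hw
      have hp : 0 < ‖w‖ := norm_pos_iff.2 h0
      rw [inner_proj _ _ h0, inner_proj _ _ h0, lt_inv_mul_iff₀ hp, lt_inv_mul_iff₀ hp,
        mul_comm, mul_comm ‖w‖ d]
      exact hw
  rw [himg]
  exact hconv.isPreconnected.image _ fun w hw => (continuousAt_proj (hne w hw)).continuousWithinAt

theorem IsNormal.neg_compl {κ : ℝ} {A : Set (Sph n)} {y : Sph n} {ν : Amb n}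
    (h : IsNormal κ A y ν) : IsNormal κ Aᶜ y (-ν) := by
  refine ⟨by rw [norm_neg, h.1], by rw [inner_neg_right, h.2.1, neg_zero], fun z => ⟨fun hz => ?_,
    fun hz => ?_⟩⟩
  · rw [inner_neg_right] at hz
    exact (h.2.2 z).2 (by linarith)
  · rw [inner_neg_right] at hz
    exact fun hzc => hzc ((h.2.2 z).1 (by linarith))

/-- Points of `A` away from the boundary have a definite height over the tangent plane. -/
theorem IsNormal.inner_gt_of_far {κ d : ℝ} (hκ : 1 ≤ κ) (hd : 0 < d) (hκd : κ * d ≤ 1 / 100000)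
    {A : Set (Sph n)} {y z : Sph n} {ν : Amb n} (h : IsNormal κ A y ν)
    (hzy : ‖(z : Amb n) - y‖ < 40 * d) (hz : ∀ f ∈ frontier A, d < ‖(z : Amb n) - f‖)
    (hzA : z ∈ A) : d / 16 < ⟪(z : Amb n), ν⟫ := by
  by_contra! hle
  have hd1 : d ≤ 1 / 100000 := by nlinarith
  -- Lowering `z` by `d / 4` would take it below the paraboloid, hence out of `A`, after a move of
  -- at most `d / 2`; the crossing would be a boundary point within `d` of `z`.
  have hw : ‖(-(d / 4)) • ν‖ = d / 4 := by
    rw [norm_smul, h.1, mul_one, Real.norm_eq_abs, abs_neg, abs_of_pos (by positivity)]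
  set v := (z : Amb n) + (-(d / 4)) • ν with hv
  have hv0 : v ≠ 0 := add_ne_zero_of_norm_lt (by rw [hw]; linarith)
  have hpz := norm_proj_sub_le v z
  rw [hv, add_sub_cancel_left, hw, ← hv] at hpz
  have hvp : 0 < ‖v‖ := norm_pos_iff.2 hv0
  have hvn : ‖v‖ ≤ 2 := by
    have := norm_add_le (z : Amb n) ((-(d / 4)) • ν)
    rw [norm_coe, hw] at this; linarith
  have hinv : 1 / 2 ≤ ‖v‖⁻¹ := by
    rw [le_inv_comm₀ (by norm_num) hvp]; linarith
  have hpy : ‖(proj v : Amb n) - y‖ ≤ 41 * d := by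
    have e : (proj v : Amb n) - y = ((proj v : Amb n) - z) + ((z : Amb n) - y) := by abel
    rw [e]; linarith [norm_add_le ((proj v : Amb n) - z) ((z : Amb n) - y)]
  have hout : proj v ∉ A := by
    apply (h.2.2 _).2
    rw [inner_proj _ _ hv0, hv, inner_add_left, real_inner_smul_left, real_inner_self_eq_norm_sq,
      h.1, ← hv]
    have e1 : κ * ‖(proj v : Amb n) - y‖ ^ 2 ≤ d / 20 := by
      calc _ ≤ κ * (41 * d) ^ 2 := by gcongr
        _ = 1681 * d * (κ * d) := by ring
        _ ≤ 1681 * d * (1 / 100000) := by gcongr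
        _ ≤ _ := by linarith
    have e2 : ‖v‖⁻¹ * (⟪(z : Amb n), ν⟫ + -(d / 4) * 1 ^ 2) ≤ 1 / 2 * (-(d / 8)) := by
      calc _ ≤ ‖v‖⁻¹ * (-(d / 8)) := by gcongr; linarith
        _ ≤ _ := mul_le_mul_of_nonpos_right hinv (by linarith)
    linarith
  obtain ⟨f, hf, hfz⟩ := exists_mem_frontier_near (A := A) (a := z) (z := proj v)
    (fun h => hout (h.1 hzA)) (by linarith)
  have := hz f hf
  rw [norm_sub_rev] at this
  linarith

theorem IsNormal.inner_lt_of_far {κ d : ℝ} (hκ : 1 ≤ κ) (hd : 0 < d) (hκd : κ * d ≤ 1 / 100000)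
    {A : Set (Sph n)} {y z : Sph n} {ν : Amb n} (h : IsNormal κ A y ν)
    (hzy : ‖(z : Amb n) - y‖ < 40 * d) (hz : ∀ f ∈ frontier A, d < ‖(z : Amb n) - f‖)
    (hzA : z ∉ A) : d / 16 < ⟪(z : Amb n), -ν⟫ :=
  h.neg_compl.inner_gt_of_far hκ hd hκd hzy (by rwa [frontier_compl]) hzA

/-- Within the ball of radius `40 d`, the boundary of `A'` is close to the tangent plane, hence
membership in `A'` is constant on each side. -/
theorem IsNormal.mem_iff_mem_of_side {κ d : ℝ} (hκ : 1 ≤ κ) (hd : 0 < d)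
    (hκd : κ * d ≤ 1 / 100000) {A A' : Set (Sph n)} (hA : IsOpen A) {y : Sph n} {ν μ : Amb n}
    (h : IsNormal κ A y ν) (hμ : μ = ν ∨ μ = -ν)
    (hF : ∀ f' ∈ frontier A', ∃ f ∈ frontier A, ‖(f' : Amb n) - f‖ ≤ d / 40)
    {z w : Sph n} (hz : ‖(z : Amb n) - y‖ < 40 * d) (hz' : d / 16 < ⟪(z : Amb n), μ⟫)
    (hw : ‖(w : Amb n) - y‖ < 40 * d) (hw' : d / 16 < ⟪(w : Amb n), μ⟫) :
    z ∈ A' ↔ w ∈ A' := by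
  have hd1 : d ≤ 1 / 100000 := by nlinarith
  refine mem_iff_mem_of_isPreconnected
    (isPreconnected_cap_inter (R := 40 * d) (d := d / 16) (by positivity) (by linarith)
      (by positivity) y μ) ?_ ⟨hz, hz'⟩ ⟨hw, hw'⟩
  rintro f' ⟨hf'y, hf'μ⟩ hf'
  obtain ⟨f, hf, hff⟩ := hF f' hf'
  have h1 := h.abs_inner_le_of_mem_frontier hA hf
  have hfy : ‖(f : Amb n) - y‖ ≤ 41 * d := by
    have e : (f : Amb n) - y = ((f' : Amb n) - y) - ((f' : Amb n) - f) := by abel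
    rw [e]; linarith [norm_sub_le ((f' : Amb n) - y) ((f' : Amb n) - f)]
  have h2 : κ * ‖(f : Amb n) - y‖ ^ 2 ≤ d / 50 := by
    calc _ ≤ κ * (41 * d) ^ 2 := by gcongr
      _ = 1681 * d * (κ * d) := by ring
      _ ≤ 1681 * d * (1 / 100000) := by gcongr
      _ ≤ _ := by linarith
  have h3 : ⟪(f' : Amb n), μ⟫ ≤ |⟪(f' : Amb n), ν⟫| := by
    rcases hμ with rfl | rfl
    · exact le_abs_self _
    · rw [inner_neg_right]; exact neg_le_abs _
  have h4 := abs_inner_le_norm_of_norm_one h.1 ((f' : Amb n) - f)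
  rw [inner_sub_left] at h4
  have h5 := abs_sub_abs_le_abs_sub ⟪(f' : Amb n), ν⟫ ⟪(f : Amb n), ν⟫
  linarith

/-- If the boundaries pass close to each other, then `A'` occupies exactly one of the sides of the
tangent plane of `A`. -/
theorem IsNormal.exists_opposite {κ d : ℝ} (hκ : 1 ≤ κ) (hd : 0 < d)
    (hκd : κ * d ≤ 1 / 100000) {A' : Set (Sph n)} {y y' : Sph n} {μ ν' : Amb n}
    (hμ : ‖μ‖ = 1) (hyμ : ⟪(y : Amb n), μ⟫ = 0) (h' : IsNormal κ A' y' ν')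
    (hyy : ‖(y' : Amb n) - y‖ ≤ d / 40) (hc : 0 ≤ ⟪ν', μ⟫) :
    ∃ p q : Sph n, p ∈ A' ∧ q ∉ A' ∧ ‖(p : Amb n) - y‖ < 40 * d ∧ ‖(q : Amb n) - y‖ < 40 * d ∧
      d / 16 < ⟪(p : Amb n), μ⟫ ∧ d / 16 < ⟪(q : Amb n), -μ⟫ := by
  have hd1 : d ≤ 1 / 100000 := by nlinarith
  -- Only `0 ≤ ⟪ν', μ⟫` is known; the tilt by `μ / 2` makes one direction climb definitely with
  -- respect to both vectors.
  set w := ν' + (1 / 2 : ℝ) • μ with hw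
  have hwn : ‖w‖ ≤ 2 := by
    have := norm_add_le ν' ((1 / 2 : ℝ) • μ)
    rw [norm_smul, hμ, h'.1] at this
    norm_num at this
    linarith
  have hw1 : 1 ≤ ⟪w, ν'⟫ := by
    rw [hw, inner_add_left, real_inner_smul_left, real_inner_self_eq_norm_sq, h'.1,
      real_inner_comm]
    linarith
  have hw2 : 1 / 2 ≤ ⟪w, μ⟫ := by
    rw [hw, inner_add_left, real_inner_smul_left, real_inner_self_eq_norm_sq, hμ]
    linarith
  have hyμ' : |⟪(y' : Amb n), μ⟫| ≤ d / 40 := by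
    have := abs_inner_le_norm_of_norm_one hμ ((y' : Amb n) - y)
    rw [inner_sub_left, hyμ, sub_zero] at this
    linarith
  have aux : ∀ s : ℝ, |s| = d → ∃ c : ℝ, 1 / 2 ≤ c ∧ (y' : Amb n) + s • w ≠ 0 ∧
      ‖(proj ((y' : Amb n) + s • w) : Amb n) - y'‖ ≤ 4 * d ∧
      ⟪(proj ((y' : Amb n) + s • w) : Amb n), ν'⟫ = c * (s * ⟪w, ν'⟫) ∧
      ⟪(proj ((y' : Amb n) + s • w) : Amb n), μ⟫ = c * (⟪(y' : Amb n), μ⟫ + s * ⟪w, μ⟫) := by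
    intro s hs
    have hsw : ‖s • w‖ ≤ 2 * d := by
      rw [norm_smul, Real.norm_eq_abs, hs]; nlinarith
    have hv0 := add_ne_zero_of_norm_lt (y := y') (w := s • w) (by linarith)
    have hvp : 0 < ‖(y' : Amb n) + s • w‖ := norm_pos_iff.2 hv0
    have hvn : ‖(y' : Amb n) + s • w‖ ≤ 2 := by
      have := norm_add_le (y' : Amb n) (s • w)
      rw [norm_coe] at this; linarith
    have hp := norm_proj_sub_le ((y' : Amb n) + s • w) y'
    rw [add_sub_cancel_left] at hp
    refine ⟨‖(y' : Amb n) + s • w‖⁻¹, ?_, hv0, by linarith, ?_, ?_⟩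
    · rw [le_inv_comm₀ (by norm_num) hvp]; linarith
    · rw [inner_proj _ _ hv0, inner_add_left, h'.2.1, zero_add, real_inner_smul_left]
    · rw [inner_proj _ _ hv0, inner_add_left, real_inner_smul_left]
  have far : ∀ p : Sph n, ‖(p : Amb n) - y'‖ ≤ 4 * d → ‖(p : Amb n) - y‖ < 40 * d := by
    intro p hp
    have e : (p : Amb n) - y = ((p : Amb n) - y') + ((y' : Amb n) - y) := by abel
    rw [e]; linarith [norm_add_le ((p : Amb n) - y') ((y' : Amb n) - y)]
  have small : ∀ p : Sph n, ‖(p : Amb n) - y'‖ ≤ 4 * d →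
      κ * ‖(p : Amb n) - y'‖ ^ 2 ≤ d / 1000 := by
    intro p hp
    calc _ ≤ κ * (4 * d) ^ 2 := by gcongr
      _ = 16 * d * (κ * d) := by ring
      _ ≤ 16 * d * (1 / 100000) := by gcongr
      _ ≤ _ := by linarith
  obtain ⟨c, hc, -, hp1, hp2, hp3⟩ := aux d (abs_of_pos hd)
  obtain ⟨c', hc', -, hq1, hq2, hq3⟩ := aux (-d) (by rw [abs_neg, abs_of_pos hd])
  have hb := abs_le.1 hyμ'
  have hdw : d * (1 / 2) ≤ d * ⟪w, μ⟫ := by gcongr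
  have hdw' : d * 1 ≤ d * ⟪w, ν'⟫ := by gcongr
  refine ⟨_, _, (h'.2.2 _).1 ?_, (h'.2.2 _).2 ?_, far _ hp1, far _ hq1, ?_, ?_⟩
  · have := small _ hp1
    rw [hp2]
    have : 1 / 2 * (d * 1) ≤ c * (d * ⟪w, ν'⟫) := by gcongr
    linarith
  · have := small _ hq1
    rw [hq2]
    have : 1 / 2 * (d * 1) ≤ c' * (d * ⟪w, ν'⟫) := by gcongr
    linarith
  · rw [hp3]
    have : 1 / 2 * (d / 4) ≤ c * (⟪(y' : Amb n), μ⟫ + d * ⟪w, μ⟫) := by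
      gcongr
      linarith
    linarith
  · rw [inner_neg_right, hq3]
    have : 1 / 2 * (d / 4) ≤ c' * (-⟪(y' : Amb n), μ⟫ + d * ⟪w, μ⟫) := by
      gcongr
      linarith
    linarith

/-- The boundary of `A'` is within distance `ρ` of the boundary of `A` and vice versa. -/
def FrontierNear (ρ : ℝ) (A A' : Set (Sph n)) : Prop :=
  (∀ f' ∈ frontier A', ∃ f ∈ frontier A, ‖(f' : Amb n) - f‖ ≤ ρ) ∧
    ∀ f ∈ frontier A, ∃ f' ∈ frontier A', ‖(f' : Amb n) - f‖ ≤ ρ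

/-- Near `y`, a point far from `∂A` lies on a definite side of the tangent plane, and its side
decides membership in `A`. Membership in `A'` is also constant on each side, with opposite values.
So the two sets agree at all such points or at none. -/
theorem agree_iff_agree_of_near_frontier {κ d : ℝ} (hκ : 1 ≤ κ) (hd : 0 < d)
    (hκd : κ * d ≤ 1 / 100000) {A A' : Set (Sph n)} (hA : HasNormals κ A) (hA' : HasNormals κ A')
    (hF : FrontierNear (d / 40) A A') {y z w : Sph n} (hy : y ∈ frontier A)
    (hz : ‖(z : Amb n) - y‖ < 40 * d) (hzf : ∀ f ∈ frontier A, d < ‖(z : Amb n) - f‖)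
    (hw : ‖(w : Amb n) - y‖ < 40 * d) (hwf : ∀ f ∈ frontier A, d < ‖(w : Amb n) - f‖) :
    (z ∈ A ↔ z ∈ A') ↔ (w ∈ A ↔ w ∈ A') := by
  obtain ⟨ν, hν⟩ := hA.2 y hy
  obtain ⟨y', hy', hyy⟩ := hF.2 y hy
  obtain ⟨ν', hν'⟩ := hA'.2 y' hy'
  have hplus : ∀ {p q : Sph n}, ‖(p : Amb n) - y‖ < 40 * d → d / 16 < ⟪(p : Amb n), ν⟫ →
      ‖(q : Amb n) - y‖ < 40 * d → d / 16 < ⟪(q : Amb n), ν⟫ → (p ∈ A' ↔ q ∈ A') :=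
    fun h1 h2 h3 h4 => hν.mem_iff_mem_of_side hκ hd hκd hA.1 (Or.inl rfl) hF.1 h1 h2 h3 h4
  have hminus : ∀ {p q : Sph n}, ‖(p : Amb n) - y‖ < 40 * d → d / 16 < ⟪(p : Amb n), -ν⟫ →
      ‖(q : Amb n) - y‖ < 40 * d → d / 16 < ⟪(q : Amb n), -ν⟫ → (p ∈ A' ↔ q ∈ A') :=
    fun h1 h2 h3 h4 => hν.mem_iff_mem_of_side hκ hd hκd hA.1 (Or.inr rfl) hF.1 h1 h2 h3 h4
  have hopp : ∃ p q : Sph n, (p ∈ A' ↔ q ∉ A') ∧ ‖(p : Amb n) - y‖ < 40 * d ∧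
      ‖(q : Amb n) - y‖ < 40 * d ∧ d / 16 < ⟪(p : Amb n), ν⟫ ∧ d / 16 < ⟪(q : Amb n), -ν⟫ := by
    rcases le_total 0 ⟪ν', ν⟫ with hc | hc
    · obtain ⟨p, q, hp, hq, h⟩ := hν'.exists_opposite hκ hd hκd hν.1 hν.2.1 hyy hc
      exact ⟨p, q, by tauto, h⟩
    · obtain ⟨p, q, hp, hq, h1, h2, h3, h4⟩ := hν'.exists_opposite (μ := -ν) hκ hd hκd
        (by rw [norm_neg, hν.1]) (by rw [inner_neg_right, hν.2.1, neg_zero]) hyy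
        (by rw [inner_neg_right]; linarith)
      rw [neg_neg] at h4
      exact ⟨q, p, by tauto, h2, h1, h4, h3⟩
  obtain ⟨p, q, hpq, hp, hq, hpν, hqν⟩ := hopp
  have key : ∀ x : Sph n, ‖(x : Amb n) - y‖ < 40 * d → (∀ f ∈ frontier A, d < ‖(x : Amb n) - f‖) →
      ((x ∈ A ↔ x ∈ A') ↔ p ∈ A') := by
    intro x hx hxf
    by_cases hxA : x ∈ A
    · have := hplus hx (hν.inner_gt_of_far hκ hd hκd hx hxf hxA) hp hpν
      tauto
    · have := hminus hx (hν.inner_lt_of_far hκ hd hκd hx hxf hxA) hq hqν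
      tauto
  rw [key z hz hzf, key w hw hwf]

theorem IsNormal.exists_far_point {κ d : ℝ} (hκ : 1 ≤ κ) (hd : 0 < d)
    (hκd : κ * d ≤ 1 / 100000) {A : Set (Sph n)} (hA : IsOpen A) {y : Sph n} {ν : Amb n}
    (h : IsNormal κ A y ν) :
    ∃ z : Sph n, ‖(z : Amb n) - y‖ ≤ 4 * d ∧ ∀ f ∈ frontier A, d < ‖(z : Amb n) - f‖ := by
  have hd1 : d ≤ 1 / 100000 := by nlinarith
  have hw : ‖(2 * d) • ν‖ = 2 * d := by
    rw [norm_smul, h.1, mul_one, Real.norm_eq_abs, abs_of_pos (by positivity)]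
  set v := (y : Amb n) + (2 * d) • ν with hv
  have hv0 : v ≠ 0 := add_ne_zero_of_norm_lt (by rw [hw]; linarith)
  have hpy := norm_proj_sub_le v y
  rw [hv, add_sub_cancel_left, hw, ← hv] at hpy
  have hvp : 0 < ‖v‖ := norm_pos_iff.2 hv0
  have hvn : ‖v‖ ≤ 5 / 4 := by
    have := norm_add_le (y : Amb n) ((2 * d) • ν)
    rw [norm_coe, hw] at this; linarith
  have hinv : 4 / 5 ≤ ‖v‖⁻¹ := by
    rw [le_inv_comm₀ (by norm_num) hvp]; linarith
  refine ⟨proj v, by linarith, fun f hf => ?_⟩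
  by_contra! hle
  have hfy : ‖(f : Amb n) - y‖ ≤ 5 * d := by
    have e : (f : Amb n) - y = ((proj v : Amb n) - y) - ((proj v : Amb n) - f) := by abel
    rw [e]; linarith [norm_sub_le ((proj v : Amb n) - y) ((proj v : Amb n) - f)]
  have h1 := (le_abs_self _).trans (h.abs_inner_le_of_mem_frontier hA hf)
  have h2 : κ * ‖(f : Amb n) - y‖ ^ 2 ≤ d / 1000 := by
    calc _ ≤ κ * (5 * d) ^ 2 := by gcongr
      _ = 25 * d * (κ * d) := by ring
      _ ≤ 25 * d * (1 / 100000) := by gcongr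
      _ ≤ _ := by linarith
  have h3 := (le_abs_self _).trans (abs_inner_le_norm_of_norm_one h.1 ((proj v : Amb n) - f))
  rw [inner_sub_left, inner_proj _ _ hv0, hv, inner_add_left, h.2.1, zero_add, real_inner_smul_left,
    real_inner_self_eq_norm_sq, h.1, ← hv] at h3
  have h4 : 4 / 5 * (2 * d * 1 ^ 2) ≤ ‖v‖⁻¹ * (2 * d * 1 ^ 2) := by gcongr
  linarith

theorem preconnectedSpace_sphere (hn : 1 ≤ n) : PreconnectedSpace (Sph n) := by
  apply isPreconnected_iff_preconnectedSpace.1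
  apply isPreconnected_sphere
  rw [← Module.finrank_eq_rank]
  simp only [finrank_euclideanSpace, Fintype.card_fin]
  exact_mod_cast (by omega : 1 < n + 1)

/-- Local alternatives become global by connectedness of the sphere. Without a common exterior point
`b`, the set `A'` could instead resemble the complement of `A`. -/
theorem mem_iff_mem_of_frontierNear (hn : 1 ≤ n) {κ d : ℝ} (hκ : 1 ≤ κ) (hd : 0 < d)
    (hκd : κ * d ≤ 1 / 100000) {A A' : Set (Sph n)} (hA : HasNormals κ A) (hA' : HasNormals κ A')
    (hF : FrontierNear (d / 40) A A') {b : Sph n} (hb : ∀ f ∈ frontier A, d < ‖(b : Amb n) - f‖)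
    (hbA : b ∉ A) (hbA' : b ∉ A') {x : Sph n} (hx : ∀ f ∈ frontier A, d < ‖(x : Amb n) - f‖) :
    x ∈ A ↔ x ∈ A' := by
  have hd1 : d ≤ 1 / 100000 := by nlinarith
  by_contra hxn
  have hconn : IsPreconnected (univ : Set (Sph n)) :=
    (preconnectedSpace_sphere hn).isPreconnected_univ
  -- The `6 * d`-neighbourhoods of the far points where `A` and `A'` agree, respectively disagree.
  -- They cover the sphere because each point within `d` of `∂A` has a far point nearby.
  let V : Prop → Set (Sph n) := fun P => {x | ∃ z : Sph n, ‖(x : Amb n) - z‖ < 6 * d ∧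
    (∀ f ∈ frontier A, d < ‖(z : Amb n) - f‖) ∧ ((z ∈ A ↔ z ∈ A') ↔ P)}
  have hVo : ∀ P, IsOpen (V P) := by
    intro P
    have : V P = ⋃ z : Sph n, ⋃ _ : (∀ f ∈ frontier A, d < ‖(z : Amb n) - f‖) ∧
        ((z ∈ A ↔ z ∈ A') ↔ P), {x : Sph n | ‖(x : Amb n) - z‖ < 6 * d} := by
      ext x
      simp only [V, mem_iUnion, mem_ofPred_eq, exists_prop]
      exact ⟨fun ⟨z, h1, h2, h3⟩ => ⟨z, ⟨h2, h3⟩, h1⟩, fun ⟨z, ⟨h2, h3⟩, h1⟩ => ⟨z, h1, h2, h3⟩⟩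
    rw [this]
    exact isOpen_iUnion fun z => isOpen_iUnion fun _ => isOpen_lt (by fun_prop) continuous_const
  have hcov : (univ : Set (Sph n)) ⊆ V True ∪ V False := by
    intro x _
    have : ∃ z : Sph n, ‖(x : Amb n) - z‖ < 6 * d ∧ (∀ f ∈ frontier A, d < ‖(z : Amb n) - f‖) := by
      by_cases hxf : ∀ f ∈ frontier A, d < ‖(x : Amb n) - f‖
      · exact ⟨x, by simpa using hd, hxf⟩
      · push Not at hxf
        obtain ⟨f, hf, hxf⟩ := hxf
        obtain ⟨ν, hν⟩ := hA.2 f hf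
        obtain ⟨z, hz, hzf⟩ := hν.exists_far_point hκ hd hκd hA.1
        refine ⟨z, ?_, hzf⟩
        have e : (x : Amb n) - z = ((x : Amb n) - f) - ((z : Amb n) - f) := by abel
        rw [e]; linarith [norm_sub_le ((x : Amb n) - f) ((z : Amb n) - f)]
    obtain ⟨z, hxz, hzf⟩ := this
    by_cases hz : z ∈ A ↔ z ∈ A'
    · exact Or.inl ⟨z, hxz, hzf, iff_true_intro hz⟩
    · exact Or.inr ⟨z, hxz, hzf, iff_false_intro hz⟩
  obtain ⟨c, -, ⟨z, hcz, hzf, hz⟩, ⟨w, hcw, hwf, hw⟩⟩ := hconn _ _ (hVo True) (hVo False) hcov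
    ⟨b, mem_univ _, b, by simpa using hd, hb, iff_true_intro (iff_of_false hbA hbA')⟩
    ⟨x, mem_univ _, x, by simpa using hd, hx, iff_false_intro hxn⟩
  have hwz : ‖(w : Amb n) - z‖ < 12 * d := by
    have e : (w : Amb n) - z = ((c : Amb n) - z) - ((c : Amb n) - w) := by abel
    rw [e]; linarith [norm_sub_le ((c : Amb n) - z) ((c : Amb n) - w)]
  -- As `z` and `w` differ in status, they are separated by `∂A` or by `∂A'`, and the latter is `d /
  -- 40`-close to `∂A`.
  have hy : ∃ y ∈ frontier A, ‖(y : Amb n) - z‖ ≤ 25 * d := by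
    by_cases h : z ∈ A ↔ w ∈ A
    · have h' : ¬ (z ∈ A' ↔ w ∈ A') := fun h' => hw.1 (h.symm.trans ((hz.2 trivial).trans h'))
      obtain ⟨y', hy', hyz⟩ := exists_mem_frontier_near h' (by linarith)
      obtain ⟨y, hy, hyy⟩ := hF.1 y' hy'
      refine ⟨y, hy, ?_⟩
      have e : (y : Amb n) - z = ((y' : Amb n) - z) - ((y' : Amb n) - y) := by abel
      rw [e]; linarith [norm_sub_le ((y' : Amb n) - z) ((y' : Amb n) - y)]
    · obtain ⟨y, hy, hyz⟩ := exists_mem_frontier_near h (by linarith)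
      exact ⟨y, hy, by linarith⟩
  obtain ⟨y, hy, hyz⟩ := hy
  have hzy : ‖(z : Amb n) - y‖ < 40 * d := by rw [norm_sub_rev]; linarith
  have hwy : ‖(w : Amb n) - y‖ < 40 * d := by
    have e : (w : Amb n) - y = ((w : Amb n) - z) - ((y : Amb n) - z) := by abel
    rw [e]; linarith [norm_sub_le ((w : Amb n) - z) ((y : Amb n) - z)]
  have := agree_iff_agree_of_near_frontier hκ hd hκd hA hA' hF hy hzy hzf hwy hwf
  exact hw.1 (this.1 (hz.2 trivial))

/-! ### From great-circle to chordal distance, and pushing fields uniform over the class -/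

theorem norm_sub_le_geoDist (x y : Sph n) : ‖(x : Amb n) - y‖ ≤ geoDist x y := by
  have h1 := inner_coe_coe x y
  rw [← cos_geoDist] at h1
  have h2 := Real.one_sub_sq_div_two_le_cos (x := geoDist x y)
  exact le_of_sq_le_sq (by linarith) (geoDist_nonneg x y)

theorem exists_geoDist_lt_of_iSup_lt {X Y : Set (Sph n)} {δ : ℝ}
    (h : (⨆ x ∈ X, ⨅ y ∈ Y, ENNReal.ofReal (geoDist x y)) < ENNReal.ofReal δ) {x : Sph n}
    (hx : x ∈ X) : ∃ y ∈ Y, geoDist x y < δ := by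
  have h1 : (⨅ y ∈ Y, ENNReal.ofReal (geoDist x y)) < ENNReal.ofReal δ :=
    (le_iSup₂ (f := fun x (_ : x ∈ X) => ⨅ y ∈ Y, ENNReal.ofReal (geoDist x y)) x hx).trans_lt h
  simp only [iInf_lt_iff] at h1
  obtain ⟨y, hy, hlt⟩ := h1
  exact ⟨y, hy, ENNReal.lt_ofReal_iff_toReal_lt ENNReal.ofReal_ne_top |>.1 hlt |>.trans_eq' (by
    rw [ENNReal.toReal_ofReal (geoDist_nonneg x y)])⟩

theorem frontierNear_of_geoHausdorff_lt {A A' : Set (Sph n)} {δ : ℝ}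
    (h : geoHausdorff (frontier A') (frontier A) < ENNReal.ofReal δ) : FrontierNear δ A A' := by
  rw [geoHausdorff, sup_lt_iff] at h
  constructor
  · intro f' hf'
    obtain ⟨f, hf, hlt⟩ := exists_geoDist_lt_of_iSup_lt h.1 hf'
    exact ⟨f, hf, (norm_sub_le_geoDist _ _).trans hlt.le⟩
  · intro f hf
    obtain ⟨f', hf', hlt⟩ := exists_geoDist_lt_of_iSup_lt
      (Y := frontier A') (by simpa only [geoDist, InnerProductGeometry.angle_comm] using h.2) hf
    refine ⟨f', hf', ?_⟩
    rw [norm_sub_rev]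
    exact (norm_sub_le_geoDist _ _).trans hlt.le

/-- A smooth vector field that is bounded and Lipschitz with constant `M`. -/
structure IsBoundedField (M : ℝ) (X : Amb n → Amb n) : Prop where
  contDiff : ContDiff ℝ ∞ X
  norm_le : ∀ x, ‖X x‖ ≤ M
  norm_sub_le : ∀ x y, ‖X x - X y‖ ≤ M * ‖x - y‖

theorem IsTransverse.isBoundedField {κ M τ : ℝ} {A : Set (Sph n)} {X : Amb n → Amb n}
    (h : IsTransverse κ M τ A X) : IsBoundedField M X :=
  ⟨h.contDiff, h.norm_le, h.norm_sub_le⟩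

theorem south_pole_last : ((proj 0 : Sph n) : Amb n) (Fin.last n) = -1 := by
  simp [proj]

/-- All the geometry of the class that the analysis uses. The field depends on `A` alone and serves
every `A'` with nearby boundary; `M` and `t₀` depend on neither. -/
theorem exists_pushing_fields (hn : 1 ≤ n) {η r : ℝ} (hη : 0 < η) (hr : 0 < r) :
    ∃ M t₀ : ℝ, 1 ≤ M ∧ 0 < t₀ ∧ ∀ A ∈ uniformClass n η r, ∃ X : Amb n → Amb n,
      IsBoundedField M X ∧
      (∀ t, 0 < t → t ≤ t₀ → ∀ a ∈ A, ∀ z : Sph n, ‖(z : Amb n) - push X t a‖ ≤ t / 16 → z ∈ A) ∧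
      ∀ t, 0 < t → t ≤ t₀ → ∀ A' ∈ uniformClass n η r,
        geoHausdorff (frontier A') (frontier A) < ENNReal.ofReal (t / 1280 * t₀) →
        (∀ a ∈ A', push X t a ∈ A) ∧ ∀ a ∈ A, push X t a ∈ A' := by
  obtain ⟨κ, hκ, hnorm⟩ := exists_hasNormals n η hr
  obtain ⟨M, τ, hM, hτ, hfield⟩ := exists_isTransverse n hκ
  have hκ0 : 0 < κ := by linarith
  have hM0 : 0 < M := by linarith
  -- The smallness required by `IsTransverse.mem_of_near_push`, with room to spare so that also `t₀
  -- ≤ 1` and `κ * t₀` is tiny.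
  set t₀ : ℝ := min (τ / (7 * M)) (1 / (1000000 * (κ * M ^ 2))) with ht₀
  have ht₀0 : 0 < t₀ := by positivity
  have h1 : 7 * M * t₀ ≤ τ := by
    have := min_le_left (τ / (7 * M)) (1 / (1000000 * (κ * M ^ 2)))
    rw [← ht₀, le_div_iff₀ (by positivity)] at this
    linarith
  have h2 : 1000000 * (κ * M ^ 2) * t₀ ≤ 1 := by
    have := min_le_right (τ / (7 * M)) (1 / (1000000 * (κ * M ^ 2)))
    rw [← ht₀, le_div_iff₀ (by positivity)] at this
    linarith
  have hκM : κ ≤ κ * M ^ 2 := le_mul_of_one_le_right hκ0.le (one_le_pow₀ hM)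
  refine ⟨M, t₀, hM, ht₀0, fun A hA => ?_⟩
  obtain ⟨X, hX⟩ := hfield A (hnorm A hA)
  have key : ∀ t, 0 < t → t ≤ t₀ → ∀ x a z : Sph n, a ∈ A → ‖(x : Amb n) - a‖ ≤ t / 16 →
      ‖(z : Amb n) - push X t x‖ ≤ t / 16 → z ∈ A := by
    intro t ht htt x a z
    refine hX.mem_of_near_push hκ hM (hnorm A hA) ht ?_ ?_
    · exact le_trans (by gcongr) h1
    · refine le_trans ?_ h2
      have : κ * M ^ 2 * t ≤ κ * M ^ 2 * t₀ := by gcongr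
      have : 0 < κ * M ^ 2 * t := by positivity
      linarith
  refine ⟨X, hX.isBoundedField, ?_, ?_⟩
  · intro t ht htt a ha z hz
    refine key t ht htt a a z ha ?_ hz
    rw [sub_self, norm_zero]; positivity
  · intro t ht htt A' hA' hdist
    -- This scale satisfies both `2 * d ≤ t / 16` and `κ * d ≤ 1 / 100000`; the assumed Hausdorff
    -- bound is exactly `d / 40`.
    set d : ℝ := t / 32 * t₀ with hd
    have hd0 : 0 < d := by positivity
    have ht01 : t₀ ≤ 1 := by nlinarith
    have hdt : 2 * d ≤ t / 16 := by
      rw [hd]; nlinarith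
    have hκt : κ * t₀ ≤ 1 / 1000000 := by nlinarith
    have hκd : κ * d ≤ 1 / 100000 := by
      calc κ * d = (κ * t₀) * (t / 32) := by rw [hd]; ring
        _ ≤ 1 / 1000000 * (1 / 32) := by gcongr; linarith
        _ ≤ _ := by norm_num
    have hd1 : d ≤ 1 := by nlinarith
    have hF : FrontierNear (d / 40) A A' := by
      apply frontierNear_of_geoHausdorff_lt
      convert hdist using 2
      rw [hd]; ring
    have hlast : ∀ B ∈ uniformClass n η r, ∀ f ∈ closure B, η < (f : Amb n) (Fin.last n) :=
      fun B hB f hf => hB.2.1 hf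
    have hpole : ∀ B ∈ uniformClass n η r, (proj 0 : Sph n) ∉ B := by
      intro B hB hmem
      have := hlast B hB _ (subset_closure hmem)
      rw [south_pole_last] at this
      linarith
    -- The pole has height `-1` and the boundary has height above `η > 0`, so their distance exceeds
    -- `1 ≥ d`.
    have hb : ∀ f ∈ frontier A, d < ‖((proj 0 : Sph n) : Amb n) - f‖ := by
      intro f hf
      have h3 := hlast A hA f (frontier_subset_closure hf)
      have h4 := PiLp.norm_apply_le (((proj 0 : Sph n) : Amb n) - (f : Amb n)) (Fin.last n)
      rw [PiLp.sub_apply, south_pole_last, Real.norm_eq_abs] at h4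
      have h5 := (neg_le_abs _).trans h4
      linarith
    have hagree : ∀ x : Sph n, (∀ f ∈ frontier A, d < ‖(x : Amb n) - f‖) → (x ∈ A ↔ x ∈ A') :=
      fun x hx => mem_iff_mem_of_frontierNear hn hκ hd0 hκd (hnorm A hA) (hnorm A' hA') hF hb
        (hpole A hA) (hpole A' hA') hx
    constructor
    · intro a' ha'
      have : ∃ a ∈ A, ‖(a' : Amb n) - a‖ ≤ t / 16 := by
        by_cases haA : a' ∈ A
        · exact ⟨a', haA, by rw [sub_self, norm_zero]; positivity⟩
        · have : ∃ f ∈ frontier A, ‖(a' : Amb n) - f‖ ≤ d := by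
            by_contra! hcon
            exact haA ((hagree a' hcon).2 ha')
          obtain ⟨f, hf, hfd⟩ := this
          obtain ⟨a, ha, had⟩ := Metric.mem_closure_iff.1 (frontier_subset_closure hf) d hd0
          rw [Subtype.dist_eq, dist_eq_norm] at had
          refine ⟨a, ha, ?_⟩
          have e : (a' : Amb n) - a = ((a' : Amb n) - f) + ((f : Amb n) - a) := by abel
          rw [e]; linarith [norm_add_le ((a' : Amb n) - f) ((f : Amb n) - a)]
      obtain ⟨a, ha, haa⟩ := this
      refine key t ht htt a' a _ ha haa ?_
      rw [sub_self, norm_zero]; positivity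
    · intro a ha
      -- With a whole `t / 16`-ball inside the open set `A`, the pushed point is farther than `d`
      -- from `∂A`, where `A` and `A'` agree.
      have hball : ∀ z : Sph n, ‖(z : Amb n) - push X t a‖ ≤ t / 16 → z ∈ A := fun z hz =>
        key t ht htt a a z ha (by rw [sub_self, norm_zero]; positivity) hz
      refine (hagree (push X t a) fun f hf => ?_).1
        (hball _ (by rw [sub_self, norm_zero]; positivity))
      by_contra! hle
      rw [hA.1.frontier_eq] at hf
      refine hf.2 (hball f ?_)
      rw [norm_sub_rev]
      linarith

/-! ### The push map is almost an isometry -/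

section PushLipschitz

variable {M t : ℝ} {X : Amb n → Amb n}

theorem IsBoundedField.add_ne_zero (hX : IsBoundedField M X) (ht : 0 ≤ t) (htM : t * M < 1)
    (x : Sph n) : (x : Amb n) + t • X x ≠ 0 :=
  add_ne_zero_of_norm_lt ((norm_smul_le_of_le ht (hX.norm_le x)).trans_lt htM)

theorem IsBoundedField.norm_push_sub_le (hX : IsBoundedField M X) (ht : 0 ≤ t) (x : Sph n) :
    ‖(push X t x : Amb n) - x‖ ≤ 2 * (t * M) := by
  have := norm_proj_sub_le ((x : Amb n) + t • X x) x
  rw [add_sub_cancel_left] at this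
  exact this.trans (by linarith [norm_smul_le_of_le ht (hX.norm_le x)])

/-- The displacement of the push has Lipschitz constant `O(t)`; this is what makes the distortion
tend to 1. -/
theorem IsBoundedField.norm_push_sub_sub_le (hX : IsBoundedField M X) (hM : 0 ≤ M) (ht : 0 ≤ t)
    (htM : t * M ≤ 1 / 100) (x y : Sph n) :
    ‖((push X t x : Amb n) - x) - ((push X t y : Amb n) - y)‖ ≤
      6 * (t * M) * ‖(x : Amb n) - y‖ := by
  set D := ‖(x : Amb n) - y‖ with hD
  have hD0 : 0 ≤ D := norm_nonneg _
  set v := (x : Amb n) + t • X x with hv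
  set w := (y : Amb n) + t • X y with hw
  have htM0 : 0 ≤ t * M := by positivity
  have h1 : ‖t • X x‖ ≤ t * M := norm_smul_le_of_le ht (hX.norm_le x)
  have h2 : ‖t • X y‖ ≤ t * M := norm_smul_le_of_le ht (hX.norm_le y)
  have h3 : ‖t • (X x - X y)‖ ≤ t * M * D := by
    rw [mul_assoc]
    exact norm_smul_le_of_le ht (hX.norm_sub_le x y)
  have hvn := abs_le.1 (abs_norm_sub_one_le v x)
  have hwn := abs_le.1 (abs_norm_sub_one_le w y)
  have hvx : v - x = t • X x := by rw [hv, add_sub_cancel_left]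
  have hwy : w - y = t • X y := by rw [hw, add_sub_cancel_left]
  rw [hvx] at hvn
  rw [hwy] at hwn
  -- Because `x` and `y` both have norm 1, every surviving term in the difference of squares carries
  -- a factor `t`.
  have hsq : |‖v‖ ^ 2 - ‖w‖ ^ 2| ≤ 5 * (t * M) * D := by
    have e : ‖v‖ ^ 2 - ‖w‖ ^ 2 = 2 * ⟪(x : Amb n) - y, t • X x⟫ +
        2 * ⟪(y : Amb n), t • (X x - X y)⟫ + ⟪t • (X x - X y), t • X x + t • X y⟫ := by
      rw [hv, hw, norm_add_sq_real, norm_add_sq_real, norm_coe, norm_coe, smul_sub,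
        inner_sub_left, inner_sub_right, inner_sub_left, inner_add_right, inner_add_right,
        real_inner_self_eq_norm_sq, real_inner_self_eq_norm_sq, real_inner_comm (t • X x) (t • X y)]
      ring
    rw [e]
    have a1 := abs_real_inner_le_norm ((x : Amb n) - y) (t • X x)
    have a2 := abs_real_inner_le_norm (y : Amb n) (t • (X x - X y))
    have a3 := abs_real_inner_le_norm (t • (X x - X y)) (t • X x + t • X y)
    have a4 := norm_add_le (t • X x) (t • X y)
    rw [norm_coe, one_mul] at a2
    have b1 : ‖(x : Amb n) - y‖ * ‖t • X x‖ ≤ D * (t * M) := by gcongr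
    have b3 : ‖t • (X x - X y)‖ * ‖t • X x + t • X y‖ ≤ t * M * D * (1 / 50) := by
      gcongr
      linarith
    have c1 := abs_le.1 (a1.trans b1)
    have c2 := abs_le.1 (a2.trans h3)
    have c3 := abs_le.1 (a3.trans b3)
    have : 0 ≤ t * M * D := by positivity
    rw [abs_le]
    constructor <;> linarith
  have hvw : |‖w‖ - ‖v‖| ≤ 3 * (t * M) * D := by
    have e : ‖v‖ ^ 2 - ‖w‖ ^ 2 = (‖v‖ - ‖w‖) * (‖v‖ + ‖w‖) := by ring
    rw [e, abs_mul, abs_of_nonneg (by positivity : 0 ≤ ‖v‖ + ‖w‖)] at hsq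
    have : |‖v‖ - ‖w‖| * (5 / 3) ≤ |‖v‖ - ‖w‖| * (‖v‖ + ‖w‖) := by gcongr; linarith
    rw [abs_sub_comm]
    linarith
  have hvwn : ‖v - w‖ ≤ (1 + t * M) * D := by
    have e : v - w = ((x : Amb n) - y) + t • (X x - X y) := by rw [hv, hw, smul_sub]; abel
    rw [e]
    linarith [norm_add_le ((x : Amb n) - y) (t • (X x - X y))]
  have hpq : ‖(push X t x : Amb n) - push X t y‖ ≤ 2 * D := by
    have e : ‖v‖ • ((push X t x : Amb n) - push X t y) =
        (v - w) + (‖w‖ - ‖v‖) • (push X t y : Amb n) := by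
      have e1 := norm_smul_proj v
      have e2 := norm_smul_proj w
      rw [smul_sub, sub_smul, push, push, ← hv, ← hw, e1, e2]
      abel
    have e3 : ‖v‖ * ‖(push X t x : Amb n) - push X t y‖ ≤ (1 + t * M) * D + 3 * (t * M) * D := by
      rw [← norm_norm v, ← norm_smul, e]
      refine (norm_add_le _ _).trans ?_
      rw [norm_smul, norm_coe, mul_one, Real.norm_eq_abs]
      linarith
    have e4 : 99 / 100 * ‖(push X t x : Amb n) - push X t y‖ ≤
        ‖v‖ * ‖(push X t x : Amb n) - push X t y‖ := by gcongr; linarith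
    nlinarith
  have e : ((push X t x : Amb n) - x) - ((push X t y : Amb n) - y) =
      (‖w‖ - ‖v‖) • (push X t x : Amb n) +
        (1 - ‖w‖) • ((push X t x : Amb n) - push X t y) + t • (X x - X y) := by
    have e1 : ‖v‖ • (push X t x : Amb n) = v := norm_smul_proj v
    have e2 : ‖w‖ • (push X t y : Amb n) = w := norm_smul_proj w
    rw [sub_smul, sub_smul, one_smul, smul_sub ‖w‖, e1, e2, hv, hw, smul_sub]
    abel
  rw [e]
  refine (norm_add₃_le).trans ?_
  rw [norm_smul, norm_smul, norm_coe, mul_one, Real.norm_eq_abs, Real.norm_eq_abs]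
  have : |1 - ‖w‖| * ‖(push X t x : Amb n) - push X t y‖ ≤ t * M * (2 * D) := by
    gcongr
    rw [abs_le]
    constructor <;> linarith
  linarith

/-- The extension of a self-map of the sphere that is positively homogeneous of degree one. -/
def homExt (Φ : Sph n → Sph n) (y : Amb n) : Amb n := ‖y‖ • (Φ (proj y) : Amb n)

theorem homExt_coe (Φ : Sph n → Sph n) (x : Sph n) : homExt Φ (x : Amb n) = Φ x := by
  rw [homExt, norm_coe, one_smul, proj_coe]

theorem homExt_smul_coe (Φ : Sph n → Sph n) {c : ℝ} (hc : 0 < c) (x : Sph n) :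
    homExt Φ (c • (x : Amb n)) = c • (Φ x : Amb n) := by
  rw [homExt, norm_smul, norm_coe, mul_one, Real.norm_eq_abs, abs_of_pos hc, proj_smul_coe hc]

/-- Lifting to `ℝ^N` reduces measure and gradient distortion on the sphere to Euclidean Lipschitz
bounds. The constant is `14 = 2 + 6 * 2`: radial change plus angular change. -/
theorem IsBoundedField.norm_homExt_sub_sub_le (hX : IsBoundedField M X) (hM : 0 ≤ M) (ht : 0 ≤ t)
    (htM : t * M ≤ 1 / 100) (y z : Amb n) :
    ‖(homExt (push X t) y - y) - (homExt (push X t) z - z)‖ ≤ 14 * (t * M) * ‖y - z‖ := by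
  have htM0 : 0 ≤ t * M := by positivity
  set g : Amb n → Amb n := fun y => (push X t (proj y) : Amb n) - proj y with hg
  have e : ∀ y, homExt (push X t) y - y = ‖y‖ • g y := by
    intro y
    rw [hg, smul_sub, norm_smul_proj, homExt]
  have e2 : ∀ a b : Amb n, ‖y‖ • a - ‖z‖ • b = (‖y‖ - ‖z‖) • a + ‖z‖ • (a - b) := by
    intro a b
    module
  have e3 : ‖z‖ • ((proj y : Amb n) - proj z) = (y - z) + (‖z‖ - ‖y‖) • (proj y : Amb n) := by
    rw [smul_sub, sub_smul, norm_smul_proj, norm_smul_proj]; abel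
  have h1 : ‖g y‖ ≤ 2 * (t * M) := hX.norm_push_sub_le ht _
  have h2 : ‖g y - g z‖ ≤ 6 * (t * M) * ‖(proj y : Amb n) - proj z‖ :=
    hX.norm_push_sub_sub_le hM ht htM _ _
  have h3 : |‖y‖ - ‖z‖| ≤ ‖y - z‖ := abs_norm_sub_norm_le y z
  have h4 : ‖z‖ * ‖(proj y : Amb n) - proj z‖ ≤ 2 * ‖y - z‖ := by
    rw [← norm_norm z, ← norm_smul, e3]
    refine (norm_add_le _ _).trans ?_
    rw [norm_smul, norm_coe, mul_one, Real.norm_eq_abs, abs_sub_comm]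
    linarith
  rw [e, e, e2]
  refine (norm_add_le _ _).trans ?_
  rw [norm_smul, norm_smul, Real.norm_eq_abs, norm_norm]
  have h5 : |‖y‖ - ‖z‖| * ‖g y‖ ≤ ‖y - z‖ * (2 * (t * M)) := by gcongr
  have h6 : ‖z‖ * ‖g y - g z‖ ≤ 6 * (t * M) * (2 * ‖y - z‖) := by
    calc _ ≤ ‖z‖ * (6 * (t * M) * ‖(proj y : Amb n) - proj z‖) := by gcongr
      _ = 6 * (t * M) * (‖z‖ * ‖(proj y : Amb n) - proj z‖) := by ring
      _ ≤ _ := by gcongr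
  linarith

theorem IsBoundedField.contMDiff_push (hX : IsBoundedField M X) (ht : 0 ≤ t) (htM : t * M < 1) :
    ContMDiff (𝓡 n) (𝓡 n) ∞ (push X t) := by
  have : Fact (Module.finrank ℝ (Amb n) = n + 1) := ⟨finrank_euclideanSpace_fin⟩
  intro x
  have h1 : ContMDiff (𝓡 n) 𝓘(ℝ, Amb n) ∞ (fun x : Sph n => (x : Amb n)) := contMDiff_coe_sphere
  have h2 : ContDiff ℝ ∞ fun y : Amb n => y + t • X y := contDiff_id.add (hX.contDiff.const_smul t)
  have h3 := h2.contMDiff.comp h1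
  exact ContMDiffAt.comp x (contMDiffAt_proj (hX.add_ne_zero ht htM x)) (h3 x)

end PushLipschitz

/-! ### Volume distortion and cones -/

section HomExt

/-- Lebesgue measure is a constant multiple of Hausdorff measure, which scales under Lipschitz maps.
-/
theorem volume_image_le_of_lipschitz {K : ℝ≥0} {f : Amb n → Amb n} (hf : LipschitzWith K f)
    (s : Set (Amb n)) :
    (volume : Measure (Amb n)) (f '' s) ≤ (K : ℝ≥0∞) ^ (n + 1) * volume s := by
  have h := Measure.isAddLeftInvariant_eq_smul (volume : Measure (Amb n)) (μH[((n + 1 : ℕ) : ℝ)])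
  have h2 := hf.hausdorffMeasure_image_le (d := ((n + 1 : ℕ) : ℝ)) (by positivity) s
  rw [h, Measure.smul_apply, Measure.smul_apply, ENNReal.smul_def, ENNReal.smul_def, smul_eq_mul,
    smul_eq_mul, mul_left_comm]
  rw [ENNReal.rpow_natCast] at h2
  gcongr

theorem volume_le_image_of_antilipschitz {K : ℝ≥0} {f : Amb n → Amb n} (hf : AntilipschitzWith K f)
    (s : Set (Amb n)) :
    (volume : Measure (Amb n)) s ≤ (K : ℝ≥0∞) ^ (n + 1) * volume (f '' s) := by
  have h := Measure.isAddLeftInvariant_eq_smul (volume : Measure (Amb n)) (μH[((n + 1 : ℕ) : ℝ)])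
  have h2 := hf.le_hausdorffMeasure_image (d := ((n + 1 : ℕ) : ℝ)) (by positivity) s
  rw [h, Measure.smul_apply, Measure.smul_apply, ENNReal.smul_def, ENNReal.smul_def, smul_eq_mul,
    smul_eq_mul, mul_left_comm]
  rw [ENNReal.rpow_natCast] at h2
  gcongr

/-- `toSphere` measures a set through the volume of the cone over it, so volume bounds for the
extension descend to the sphere. -/
theorem homExt_image_cone (Φ : Sph n → Sph n) (B : Set (Sph n)) :
    homExt Φ '' (Ioo (0 : ℝ) 1 • ((↑) '' B : Set (Amb n))) =
      Ioo (0 : ℝ) 1 • ((↑) '' (Φ '' B) : Set (Amb n)) := by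
  ext y
  constructor
  · rintro ⟨_, ⟨c, hc, _, ⟨x, hx, rfl⟩, rfl⟩, rfl⟩
    simp only
    rw [homExt_smul_coe Φ hc.1]
    exact ⟨c, hc, _, ⟨Φ x, ⟨x, hx, rfl⟩, rfl⟩, rfl⟩
  · rintro ⟨c, hc, _, ⟨_, ⟨x, hx, rfl⟩, rfl⟩, rfl⟩
    exact ⟨c • (x : Amb n), ⟨c, hc, _, ⟨x, hx, rfl⟩, rfl⟩, homExt_smul_coe Φ hc.1 x⟩

end HomExt

/-! ### Gradients of radial extensions -/

theorem contDiffAt_radialExt {A : Set (Sph n)} (hA : IsOpen A) {u : Sph n → ℝ}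
    (hu : ContMDiffOn (𝓡 n) 𝓘(ℝ, ℝ) ∞ u A) {y : Amb n} (hy : y ≠ 0) (hyA : proj y ∈ A) :
    ContDiffAt ℝ ∞ (radialExt u) y := by
  have h1 : ContMDiffAt 𝓘(ℝ, Amb n) 𝓘(ℝ, ℝ) ∞ (u ∘ proj) y :=
    ContMDiffAt.comp y (hu.contMDiffAt (hA.mem_nhds hyA)) (contMDiffAt_proj hy)
  refine (contMDiffAt_iff_contDiffAt.1 h1).congr_of_eventuallyEq ?_
  filter_upwards [isOpen_ne.mem_nhds hy] with z hz
  exact radialExt_eq u hz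

theorem norm_gradient_eq (f : Amb n → ℝ) (y : Amb n) : ‖gradient f y‖ = ‖fderiv ℝ f y‖ := by
  rw [gradient, LinearIsometryEquiv.norm_map]

theorem continuousOn_sphGrad {A : Set (Sph n)} (hA : IsOpen A) {u : Sph n → ℝ}
    (hu : ContMDiffOn (𝓡 n) 𝓘(ℝ, ℝ) ∞ u A) : ContinuousOn (sphGrad u) A := by
  intro x hx
  apply ContinuousAt.continuousWithinAt
  have h1 := contDiffAt_radialExt hA hu (coe_ne_zero x) (by rwa [proj_coe])
  have h2 : ContinuousAt (fderiv ℝ (radialExt u)) (x : Amb n) :=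
    (h1.fderiv_right (m := 0) (by simp)).continuousAt
  have h3 : ContinuousAt (fun x : Sph n => fderiv ℝ (radialExt u) (x : Amb n)) x :=
    ContinuousAt.comp (f := fun x : Sph n => (x : Amb n)) h2 continuous_subtype_val.continuousAt
  exact (LinearIsometryEquiv.continuous _).continuousAt.comp h3

theorem radialExt_smul (u : Sph n → ℝ) {c : ℝ} (hc : 0 < c) (y : Amb n) :
    radialExt u (c • y) = radialExt u y := by
  by_cases hy : y = 0
  · simp [hy]
  · rw [radialExt_eq u hy, radialExt_eq u (smul_ne_zero hc.ne' hy), proj_smul hc hy]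

theorem norm_fderiv_radialExt (u : Sph n → ℝ) {y : Amb n} (hy : y ≠ 0) :
    ‖fderiv ℝ (radialExt u) y‖ = ‖y‖⁻¹ * ‖sphGrad u (proj y)‖ := by
  have hc : 0 < ‖y‖⁻¹ := inv_pos.2 (norm_pos_iff.2 hy)
  have h1 : (fun z => radialExt u (‖y‖⁻¹ • z)) = radialExt u := by
    funext z
    exact radialExt_smul u hc z
  have h2 := fderiv_comp_smul (𝕜 := ℝ) (f := radialExt u) (x := y) ‖y‖⁻¹
  rw [h1, ← coe_proj hy] at h2
  rw [h2, norm_smul, sphGrad, norm_gradient_eq, Real.norm_eq_abs, abs_of_pos hc]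

theorem radialExt_comp (u : Sph n → ℝ) (Φ : Sph n → Sph n) {y : Amb n} (hy : y ≠ 0) :
    radialExt (u ∘ Φ) y = radialExt u (homExt Φ y) := by
  rw [radialExt_eq _ hy, homExt, radialExt_smul _ (norm_pos_iff.2 hy),
    radialExt_eq _ (coe_ne_zero _), proj_coe, Function.comp]

theorem contDiffAt_homExt {Φ : Sph n → Sph n} (hΦ : ContMDiff (𝓡 n) (𝓡 n) ∞ Φ) {y : Amb n}
    (hy : y ≠ 0) : ContDiffAt ℝ ∞ (homExt Φ) y := by
  have : Fact (Module.finrank ℝ (Amb n) = n + 1) := ⟨finrank_euclideanSpace_fin⟩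
  have h1 : ContMDiff (𝓡 n) 𝓘(ℝ, Amb n) ∞ (fun x : Sph n => (x : Amb n)) := contMDiff_coe_sphere
  have h2 : ContMDiffAt 𝓘(ℝ, Amb n) 𝓘(ℝ, Amb n) ∞ (fun y => (Φ (proj y) : Amb n)) y :=
    ContMDiffAt.comp y (g := fun x => (Φ x : Amb n)) (h1.comp hΦ).contMDiffAt (contMDiffAt_proj hy)
  exact (contDiffAt_id.norm ℝ hy).smul (contMDiffAt_iff_contDiffAt.1 h2)

/-- A smooth injective self-map of the sphere that changes measures and gradients at most by the
factor `J`. -/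
structure IsQuasiIsometry (J : ℝ≥0) (Φ : Sph n → Sph n) : Prop where
  one_le : 1 ≤ J
  contMDiff : ContMDiff (𝓡 n) (𝓡 n) ∞ Φ
  injective : Function.Injective Φ
  measure_image_le : ∀ B, MeasurableSet B → surf n (Φ '' B) ≤ J * surf n B
  le_measure_image : ∀ B, MeasurableSet B → surf n B ≤ J * surf n (Φ '' B)
  norm_sphGrad_le : ∀ A : Set (Sph n), IsOpen A → ∀ u : Sph n → ℝ,
    ContMDiffOn (𝓡 n) 𝓘(ℝ, ℝ) ∞ u A → ∀ x, Φ x ∈ A → ‖sphGrad (u ∘ Φ) x‖ ≤ J * ‖sphGrad u (Φ x)‖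

/-- With `L = 14 * (t * M)`, the homogeneous extension is the identity plus an `L`-Lipschitz map,
hence Lipschitz with constant `1 + L ≤ (1 - L)⁻¹` and antilipschitz with constant `(1 - L)⁻¹`.
Volume costs the power `n + 1`, gradients only the first power by the chain rule. -/
theorem IsBoundedField.isQuasiIsometry_push {M t : ℝ} {X : Amb n → Amb n}
    (hX : IsBoundedField M X) (hM : 0 ≤ M) (ht : 0 ≤ t) (htM : t * M ≤ 1 / 100) {J : ℝ≥0}
    (hJ : ((1 - 14 * (t * M))⁻¹) ^ (n + 1) ≤ J) : IsQuasiIsometry J (push X t) := by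
  set L : ℝ := 14 * (t * M) with hL
  have hL0 : 0 ≤ L := by positivity
  have hL1 : L ≤ 14 / 100 := by linarith
  have hsub := hX.norm_homExt_sub_sub_le hM ht htM
  rw [← hL] at hsub
  have hsm := hX.contMDiff_push ht (by linarith)
  let K₁ : ℝ≥0 := ⟨1 + L, by linarith⟩
  let K₂ : ℝ≥0 := ⟨(1 - L)⁻¹, inv_nonneg.2 (by linarith)⟩
  have hK12 : K₁ ≤ K₂ := by
    change 1 + L ≤ (1 - L)⁻¹
    rw [le_inv_comm₀ (by linarith) (by linarith), inv_eq_one_div, le_div_iff₀ (by linarith)]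
    nlinarith
  have hK1 : 1 ≤ K₂ := le_trans (show (1 : ℝ) ≤ 1 + L by linarith) hK12
  have hKJ : K₂ ^ (n + 1) ≤ J := hJ
  have hKJ' : K₂ ≤ J := (le_self_pow hK1 (Nat.succ_ne_zero n)).trans hKJ
  have hlip : LipschitzWith K₁ (homExt (push X t)) := by
    refine LipschitzWith.of_dist_le_mul fun y z => ?_
    rw [dist_eq_norm, dist_eq_norm]
    change _ ≤ (1 + L) * _
    have e : homExt (push X t) y - homExt (push X t) z =
      ((homExt (push X t) y - y) - (homExt (push X t) z - z)) + (y - z) := by abel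
    rw [e]
    refine (norm_add_le _ _).trans ?_
    linarith [hsub y z]
  have hanti : AntilipschitzWith K₂ (homExt (push X t)) := by
    refine AntilipschitzWith.of_le_mul_dist fun y z => ?_
    rw [dist_eq_norm, dist_eq_norm]
    change _ ≤ (1 - L)⁻¹ * _
    rw [le_inv_mul_iff₀ (by linarith)]
    have e : y - z = (homExt (push X t) y - homExt (push X t) z) -
      ((homExt (push X t) y - y) - (homExt (push X t) z - z)) := by abel
    have := _root_.norm_sub_le (homExt (push X t) y - homExt (push X t) z)
      ((homExt (push X t) y - y) - (homExt (push X t) z - z))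
    rw [← e] at this
    linarith [hsub y z]
  have hinj : Function.Injective (push X t) := by
    intro x y hxy
    apply Subtype.ext
    apply hanti.injective
    rw [homExt_coe, homExt_coe, hxy]
  have hemb := hsm.continuous.measurableEmbedding hinj
  refine ⟨hK1.trans hKJ', hsm, hinj, fun B hB => ?_, fun B hB => ?_, fun A hA u hu x hx => ?_⟩
  · rw [Measure.toSphere_apply' _ hB, Measure.toSphere_apply' _ (hemb.measurableSet_image.2 hB),
      ← homExt_image_cone, mul_left_comm]
    gcongr
    refine (volume_image_le_of_lipschitz hlip _).trans ?_
    gcongr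
    exact_mod_cast (pow_le_pow_left' hK12 _).trans hKJ
  · rw [Measure.toSphere_apply' _ hB, Measure.toSphere_apply' _ (hemb.measurableSet_image.2 hB),
      ← homExt_image_cone, mul_left_comm]
    gcongr
    refine (volume_le_image_of_antilipschitz hanti _).trans ?_
    gcongr
    exact_mod_cast hKJ
  · have h1 : radialExt (u ∘ push X t) =ᶠ[𝓝 (x : Amb n)] radialExt u ∘ homExt (push X t) := by
      filter_upwards [isOpen_ne.mem_nhds (coe_ne_zero x)] with z hz
      exact radialExt_comp u _ hz
    have h2 : DifferentiableAt ℝ (homExt (push X t)) (x : Amb n) :=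
      (contDiffAt_homExt hsm (coe_ne_zero x)).differentiableAt (by simp)
    have h3 : DifferentiableAt ℝ (radialExt u) (homExt (push X t) x) := by
      rw [homExt_coe]
      exact (contDiffAt_radialExt hA hu (coe_ne_zero _) (by rwa [proj_coe])).differentiableAt
        (by simp)
    rw [sphGrad, norm_gradient_eq, h1.fderiv_eq, fderiv_comp _ h3 h2, sphGrad, norm_gradient_eq,
      ← homExt_coe, mul_comm]
    refine (ContinuousLinearMap.opNorm_comp_le _ _).trans ?_
    gcongr
    refine (norm_fderiv_le_of_lipschitz ℝ hlip).trans ?_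
    exact_mod_cast hK12.trans hKJ'

theorem exists_time_isQuasiIsometry {M : ℝ} (n : ℕ) (hM : 0 < M) {J : ℝ≥0} (hJ : 1 < J) :
    ∃ t₁ : ℝ, 0 < t₁ ∧ ∀ X : Amb n → Amb n, IsBoundedField M X → ∀ t, 0 ≤ t → t ≤ t₁ →
      t * M ≤ 1 / 100 ∧ IsQuasiIsometry J (push X t) := by
  have hc : ContinuousAt (fun s : ℝ => ((1 - 14 * (s * M))⁻¹) ^ (n + 1)) 0 := by
    apply ContinuousAt.pow
    apply ContinuousAt.inv₀
    · fun_prop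
    · simp
  have h1 : ∀ᶠ s in 𝓝 (0 : ℝ), ((1 - 14 * (s * M))⁻¹) ^ (n + 1) < J := by
    apply hc.eventually_lt continuousAt_const
    simpa using hJ
  obtain ⟨ε, hε, hball⟩ := Metric.eventually_nhds_iff.1 h1
  refine ⟨min (ε / 2) (1 / (100 * M)), by positivity, fun X hX t ht htt => ?_⟩
  have h2 : t * M ≤ 1 / 100 := by
    have := htt.trans (min_le_right _ _)
    rw [le_div_iff₀ (by positivity)] at this
    linarith
  refine ⟨h2, hX.isQuasiIsometry_push hM.le ht h2 (hball ?_).le⟩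
  rw [Real.dist_eq, sub_zero, abs_of_nonneg ht]
  linarith [htt.trans (min_le_left _ _)]

/-! ### Transfer of `L²` norms -/

theorem IsQuasiIsometry.measurableEmbedding {J : ℝ≥0} {Φ : Sph n → Sph n}
    (h : IsQuasiIsometry J Φ) : MeasurableEmbedding Φ :=
  h.contMDiff.continuous.measurableEmbedding h.injective

theorem eLpNorm_smul_measure_le_mul {α E : Type*} [MeasurableSpace α] [NormedAddCommGroup E]
    {J : ℝ≥0} (hJ : 1 ≤ J) (f : α → E) (μ : Measure α) :
    eLpNorm f 2 ((J : ℝ≥0∞) • μ) ≤ J * eLpNorm f 2 μ := by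
  rw [eLpNorm_smul_measure_of_ne_top (by simp), smul_eq_mul]
  gcongr
  calc (J : ℝ≥0∞) ^ (1 / (2 : ℝ≥0∞)).toReal ≤ (J : ℝ≥0∞) ^ (1 : ℝ) := by
        apply ENNReal.rpow_le_rpow_of_exponent_le (by exact_mod_cast hJ)
        norm_num
    _ = J := ENNReal.rpow_one _

theorem IsQuasiIsometry.eLpNorm_comp_le {E : Type*} [NormedAddCommGroup E] {J : ℝ≥0}
    {Φ : Sph n → Sph n} (h : IsQuasiIsometry J Φ) (f : Sph n → E) {B : Set (Sph n)}
    (hB : MeasurableSet B) :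
    eLpNorm (f ∘ Φ) 2 ((surf n).restrict B) ≤ J * eLpNorm f 2 ((surf n).restrict (Φ '' B)) := by
  rw [← h.measurableEmbedding.eLpNorm_map_measure]
  refine le_trans (eLpNorm_mono_measure f ?_) (eLpNorm_smul_measure_le_mul h.one_le f _)
  refine Measure.le_iff.2 fun E hE => ?_
  have hE' := h.measurableEmbedding.measurable hE
  rw [Measure.map_apply h.measurableEmbedding.measurable hE, Measure.restrict_apply hE',
    Measure.smul_apply, Measure.restrict_apply hE, smul_eq_mul, inter_comm E,
    ← image_inter_preimage, inter_comm]
  exact h.le_measure_image _ (hB.inter hE')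

theorem IsQuasiIsometry.eLpNorm_image_le {E : Type*} [NormedAddCommGroup E] {J : ℝ≥0}
    {Φ : Sph n → Sph n} (h : IsQuasiIsometry J Φ) (f : Sph n → E) {B : Set (Sph n)}
    (hB : MeasurableSet B) :
    eLpNorm f 2 ((surf n).restrict (Φ '' B)) ≤ J * eLpNorm (f ∘ Φ) 2 ((surf n).restrict B) := by
  rw [← h.measurableEmbedding.eLpNorm_map_measure]
  refine le_trans (eLpNorm_mono_measure f ?_) (eLpNorm_smul_measure_le_mul h.one_le f _)
  refine Measure.le_iff.2 fun E hE => ?_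
  have hE' := h.measurableEmbedding.measurable hE
  rw [Measure.smul_apply, Measure.map_apply h.measurableEmbedding.measurable hE,
    Measure.restrict_apply hE', Measure.restrict_apply hE, smul_eq_mul, inter_comm E,
    ← image_inter_preimage, inter_comm (Φ ⁻¹' E)]
  exact h.measure_image_le _ (hB.inter hE')

/-! ### Displacement estimate -/

theorem eLpNorm_two_sq {α E : Type*} [MeasurableSpace α] [NormedAddCommGroup E] (f : α → E)
    (μ : Measure α) : eLpNorm f 2 μ ^ 2 = ∫⁻ x, ‖f x‖ₑ ^ 2 ∂μ := by
  have := eLpNorm_nnreal_pow_eq_lintegral (p := 2) (f := f) (μ := μ) (by norm_num)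
  simpa using this

theorem lintegral_sq_le {α : Type*} [MeasurableSpace α] {μ : Measure α} {g : α → ℝ≥0∞}
    (hg : AEMeasurable g μ) : (∫⁻ x, g x ∂μ) ^ 2 ≤ μ univ * ∫⁻ x, g x ^ 2 ∂μ := by
  have h := ENNReal.lintegral_mul_le_Lp_mul_Lq μ Real.HolderConjugate.two_two hg
    (aemeasurable_const (b := (1 : ℝ≥0∞)))
  simp only [Pi.mul_apply, mul_one, ENNReal.rpow_ofNat, one_pow, lintegral_one] at h
  calc _ ≤ ((∫⁻ x, g x ^ 2 ∂μ) ^ (1 / 2 : ℝ) * μ univ ^ (1 / 2 : ℝ)) ^ 2 := by gcongr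
    _ = _ := by
      rw [mul_pow, ← ENNReal.rpow_natCast, ← ENNReal.rpow_natCast, ← ENNReal.rpow_mul,
        ← ENNReal.rpow_mul, mul_comm]
      norm_num

theorem continuousAt_push {M : ℝ} {X : Amb n → Amb n} (hX : IsBoundedField M X) {s : ℝ}
    (hs : 0 ≤ s) (hsM : s * M < 1) (x : Sph n) :
    ContinuousAt (fun p : Sph n × ℝ => push X p.2 p.1) (x, s) := by
  have hXc : Continuous X := hX.contDiff.continuous
  exact ContinuousAt.comp (f := fun p : Sph n × ℝ => (p.1 : Amb n) + p.2 • X p.1)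
    (continuousAt_proj (hX.add_ne_zero hs hsM x)) (by fun_prop)

/-- The fundamental theorem of calculus for the radial extension along the straight path `x + s • X
x`. Its velocity is bounded by `M`, and degree-zero homogeneity costs `‖y s‖⁻¹ ≤ 2`. -/
theorem IsBoundedField.enorm_push_sub_le {M t : ℝ} {X : Amb n → Amb n} (hX : IsBoundedField M X)
    (hM : 0 ≤ M) (ht : 0 ≤ t) (htM : t * M ≤ 1 / 100) {A : Set (Sph n)} (hA : IsOpen A)
    {x : Sph n} (hx : ∀ s, 0 ≤ s → s ≤ t → push X s x ∈ A) {v : Sph n → ℝ}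
    (hv : ContMDiffOn (𝓡 n) 𝓘(ℝ, ℝ) ∞ v A) :
    ‖v (push X t x) - v x‖ₑ ≤
      ∫⁻ s in Ioc 0 t, ENNReal.ofReal (2 * M) * ‖sphGrad v (push X s x)‖ₑ := by
  set y : ℝ → Amb n := fun s => (x : Amb n) + s • X x with hy
  have hsM : ∀ s ∈ uIcc 0 t, 0 ≤ s ∧ s ≤ t ∧ s * M ≤ 1 / 100 := by
    intro s hs
    rw [uIcc_of_le ht] at hs
    exact ⟨hs.1, hs.2, le_trans (by gcongr; exact hs.2) htM⟩
  have hy0 : ∀ s ∈ uIcc 0 t, y s ≠ 0 := fun s hs =>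
    hX.add_ne_zero (hsM s hs).1 (by linarith [(hsM s hs).2.2]) x
  have hcd : ∀ s ∈ uIcc 0 t, ContDiffAt ℝ ∞ (radialExt v) (y s) := fun s hs =>
    contDiffAt_radialExt hA hv (hy0 s hs) (hx s (hsM s hs).1 (hsM s hs).2.1)
  have hyd : ∀ s, HasDerivAt y (X x) s := by
    intro s
    have h := ((hasDerivAt_id s).smul_const (X x)).const_add (x : Amb n)
    rw [one_smul] at h
    exact h
  have hd : ∀ s ∈ uIcc 0 t,
      HasDerivAt (fun s => radialExt v (y s)) (fderiv ℝ (radialExt v) (y s) (X x)) s := by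
    intro s hs
    exact ((hcd s hs).differentiableAt (by simp)).hasFDerivAt.comp_hasDerivAt s (hyd s)
  have hc : ContinuousOn (fun s => fderiv ℝ (radialExt v) (y s) (X x)) (uIcc 0 t) := by
    intro s hs
    apply ContinuousAt.continuousWithinAt
    have h2 : ContinuousAt (fderiv ℝ (radialExt v)) (y s) :=
      ((hcd s hs).fderiv_right (m := 0) (by simp)).continuousAt
    exact (ContinuousAt.comp (f := y) h2 (hyd s).continuousAt).clm_apply continuousAt_const
  have hftc := intervalIntegral.integral_eq_sub_of_hasDerivAt hd hc.intervalIntegrable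
  have e0 : radialExt v (y 0) = v x := by
    rw [radialExt_eq v (hy0 0 (by simp)), hy]
    simp [proj_coe]
  have e1 : radialExt v (y t) = v (push X t x) := radialExt_eq v (hy0 t (by simp))
  rw [e0, e1] at hftc
  rw [← hftc, intervalIntegral.integral_of_le ht]
  refine (enorm_integral_le_lintegral_enorm _).trans ?_
  refine setLIntegral_mono' measurableSet_Ioc fun s hs => ?_
  have hs' : s ∈ uIcc 0 t := by rw [uIcc_of_le ht]; exact ⟨hs.1.le, hs.2⟩
  rw [← ofReal_norm, ← ofReal_norm, ← ENNReal.ofReal_mul (by positivity)]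
  apply ENNReal.ofReal_le_ofReal
  have hn : 1 / 2 ≤ ‖y s‖ := by
    have h1 := abs_le.1 (abs_norm_sub_one_le (y s) x)
    have h2 := norm_smul_le_of_le (hsM s hs').1 (hX.norm_le x)
    rw [hy] at h1 ⊢
    simp only [add_sub_cancel_left] at h1 ⊢
    linarith [(hsM s hs').2.2]
  have hinv : ‖y s‖⁻¹ ≤ 2 := by
    rw [inv_le_comm₀ (by linarith) (by norm_num)]; linarith
  calc _ ≤ ‖fderiv ℝ (radialExt v) (y s)‖ * ‖X x‖ := ContinuousLinearMap.le_opNorm _ _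
    _ = ‖y s‖⁻¹ * ‖sphGrad v (push X s x)‖ * ‖X x‖ := by
      rw [norm_fderiv_radialExt v (hy0 s hs')]; rfl
    _ ≤ 2 * ‖sphGrad v (push X s x)‖ * M := by
      gcongr
      exact hX.norm_le x
    _ = _ := by ring

/-- Cauchy–Schwarz in time, then Tonelli; each time slice is bounded by the quasi-isometry `push X
s`, which keeps `A` inside `A`. -/
theorem IsBoundedField.eLpNorm_push_sub_le {M t : ℝ} {X : Amb n → Amb n}
    (hX : IsBoundedField M X) (hM : 0 ≤ M) (ht : 0 ≤ t) (htM : t * M ≤ 1 / 100) {J : ℝ≥0}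
    (hJ : ∀ s, 0 ≤ s → s ≤ t → IsQuasiIsometry J (push X s)) {A : Set (Sph n)} (hA : IsOpen A)
    (hx : ∀ s, 0 ≤ s → s ≤ t → ∀ x ∈ A, push X s x ∈ A) {v : Sph n → ℝ}
    (hv : ContMDiffOn (𝓡 n) 𝓘(ℝ, ℝ) ∞ v A) :
    eLpNorm (fun x => v (push X t x) - v x) 2 ((surf n).restrict A) ≤
      ENNReal.ofReal (2 * M * t) * J * eLpNorm (sphGrad v) 2 ((surf n).restrict A) := by
  set N := eLpNorm (sphGrad v) 2 ((surf n).restrict A) with hN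
  have hgc : ContinuousOn (fun p : Sph n × ℝ => ‖sphGrad v (push X p.2 p.1)‖ₑ) (A ×ˢ Ioc 0 t) := by
    rintro ⟨x, s⟩ ⟨hxA, hs⟩
    apply ContinuousAt.continuousWithinAt
    have hsM : s * M < 1 := by
      have : s * M ≤ t * M := by gcongr; exact hs.2
      linarith
    have h1 : ContinuousAt (sphGrad v) (push X s x) :=
      (continuousOn_sphGrad hA hv).continuousAt (hA.mem_nhds (hx s hs.1.le hs.2 x hxA))
    exact (ContinuousAt.comp (f := fun p : Sph n × ℝ => push X p.2 p.1) h1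
      (continuousAt_push hX hs.1.le hsM x)).enorm
  have hgm : AEMeasurable (fun p : Sph n × ℝ => ‖sphGrad v (push X p.2 p.1)‖ₑ)
      (((surf n).restrict A).prod (volume.restrict (Ioc 0 t))) := by
    rw [Measure.prod_restrict]
    exact hgc.aemeasurable (hA.measurableSet.prod measurableSet_Ioc)
  have hgs : ∀ x ∈ A, AEMeasurable (fun s : ℝ => ‖sphGrad v (push X s x)‖ₑ)
      (volume.restrict (Ioc 0 t)) := by
    intro x hxA
    refine ContinuousOn.aemeasurable ?_ measurableSet_Ioc
    exact ContinuousOn.comp (f := fun s : ℝ => (x, s)) hgc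
      (Continuous.continuousOn (Continuous.prodMk continuous_const continuous_id))
      fun s hs => ⟨hxA, hs⟩
  have hsl : ∀ s ∈ Ioc 0 t, ∫⁻ x in A, ‖sphGrad v (push X s x)‖ₑ ^ 2 ∂(surf n) ≤ (J * N) ^ 2 := by
    intro s hs
    have hJs := hJ s hs.1.le hs.2
    have h1 := eLpNorm_two_sq (sphGrad v ∘ push X s) ((surf n).restrict A)
    simp only [Function.comp] at h1
    rw [← h1]
    gcongr
    refine (hJs.eLpNorm_comp_le (sphGrad v) hA.measurableSet).trans ?_
    gcongr
    refine eLpNorm_mono_measure _ (Measure.restrict_mono ?_ le_rfl)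
    rintro _ ⟨x, hxA, rfl⟩
    exact hx s hs.1.le hs.2 x hxA
  have hsq : eLpNorm (fun x => v (push X t x) - v x) 2 ((surf n).restrict A) ^ 2 ≤
      (ENNReal.ofReal (2 * M * t) * J * N) ^ 2 := by
    rw [eLpNorm_two_sq]
    calc ∫⁻ x in A, ‖v (push X t x) - v x‖ₑ ^ 2 ∂(surf n)
        ≤ ∫⁻ x in A, (ENNReal.ofReal t * ENNReal.ofReal (2 * M) ^ 2) *
            (∫⁻ s in Ioc 0 t, ‖sphGrad v (push X s x)‖ₑ ^ 2) ∂(surf n) := by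
          refine setLIntegral_mono' hA.measurableSet fun x hxA => ?_
          have h1 := hX.enorm_push_sub_le hM ht htM hA
            (fun s hs0 hs1 => hx s hs0 hs1 x hxA) hv
          rw [lintegral_const_mul'' _ (hgs x hxA)] at h1
          calc _ ≤ (ENNReal.ofReal (2 * M) *
                  ∫⁻ s in Ioc 0 t, ‖sphGrad v (push X s x)‖ₑ) ^ 2 := by gcongr
            _ ≤ ENNReal.ofReal (2 * M) ^ 2 * (ENNReal.ofReal t *
                  ∫⁻ s in Ioc 0 t, ‖sphGrad v (push X s x)‖ₑ ^ 2) := by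
              rw [mul_pow]
              gcongr
              refine (lintegral_sq_le (hgs x hxA)).trans (le_of_eq ?_)
              simp
            _ = _ := by ring
      _ = (ENNReal.ofReal t * ENNReal.ofReal (2 * M) ^ 2) *
            ∫⁻ x in A, (∫⁻ s in Ioc 0 t, ‖sphGrad v (push X s x)‖ₑ ^ 2) ∂(surf n) := by
          rw [lintegral_const_mul']
          exact ENNReal.mul_ne_top ENNReal.ofReal_ne_top (ENNReal.pow_ne_top ENNReal.ofReal_ne_top)
      _ = (ENNReal.ofReal t * ENNReal.ofReal (2 * M) ^ 2) *
            ∫⁻ s in Ioc 0 t, (∫⁻ x in A, ‖sphGrad v (push X s x)‖ₑ ^ 2 ∂(surf n)) := by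
          rw [lintegral_lintegral_swap]
          exact hgm.pow_const 2
      _ ≤ (ENNReal.ofReal t * ENNReal.ofReal (2 * M) ^ 2) *
            ∫⁻ s in Ioc 0 t, (J * N) ^ 2 :=
          mul_le_mul' le_rfl (setLIntegral_mono' measurableSet_Ioc hsl)
      _ = _ := by
          rw [setLIntegral_const, Real.volume_Ioc, sub_zero,
            ENNReal.ofReal_mul (p := 2 * M) (by positivity)]
          ring
  exact (ENNReal.pow_le_pow_left_iff two_ne_zero).1 hsq

/-! ### The layer estimate -/

section Layer

variable {J : ℝ≥0} {Φ : Sph n → Sph n}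

theorem IsQuasiIsometry.measurableEmbedding_iterate (h : IsQuasiIsometry J Φ) (j : ℕ) :
    MeasurableEmbedding Φ^[j] := by
  induction j with
  | zero => exact MeasurableEmbedding.id
  | succ j ih => exact ih.comp h.measurableEmbedding

theorem IsQuasiIsometry.eLpNorm_comp_iterate_le {E : Type*} [NormedAddCommGroup E]
    (h : IsQuasiIsometry J Φ) (f : Sph n → E) (j : ℕ) {B : Set (Sph n)} (hB : MeasurableSet B) :
    eLpNorm (f ∘ Φ^[j]) 2 ((surf n).restrict B) ≤
      J ^ j * eLpNorm f 2 ((surf n).restrict (Φ^[j] '' B)) := by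
  induction j generalizing B with
  | zero => simp
  | succ j ih =>
    have h1 := h.eLpNorm_comp_le (f ∘ Φ^[j]) hB
    have h2 := ih (h.measurableEmbedding.measurableSet_image.2 hB)
    rw [← image_comp, ← Function.iterate_succ] at h2
    rw [Function.comp_assoc, ← Function.iterate_succ] at h1
    calc _ ≤ _ := h1
      _ ≤ J * (J ^ j * eLpNorm f 2 ((surf n).restrict (Φ^[j + 1] '' B))) := by gcongr
      _ = _ := by ring

/-- Telescoping along the orbit, with one factor `J` per change of variables. -/
theorem IsQuasiIsometry.eLpNorm_iterate_sub_le (h : IsQuasiIsometry J Φ) {A : Set (Sph n)}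
    (hA : IsOpen A) (hΦ : MapsTo Φ A A) {v : Sph n → ℝ} (hv : ContinuousOn v A) (j : ℕ) :
    eLpNorm (fun x => v (Φ^[j] x) - v x) 2 ((surf n).restrict A) ≤
      j * J ^ j * eLpNorm (fun x => v (Φ x) - v x) 2 ((surf n).restrict A) := by
  set D := eLpNorm (fun x => v (Φ x) - v x) 2 ((surf n).restrict A) with hD
  have hc : ∀ j, ContinuousOn (fun x => v (Φ^[j] x)) A := fun j =>
    hv.comp (h.contMDiff.continuous.iterate j).continuousOn (hΦ.iterate j)
  have hJ : (1 : ℝ≥0∞) ≤ J := by exact_mod_cast h.one_le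
  induction j with
  | zero => simp
  | succ j ih =>
    have e : (fun x => v (Φ^[j + 1] x) - v x) =
        ((fun x => v (Φ^[j] x) - v x) ∘ Φ) + fun x => v (Φ x) - v x := by
      funext x
      simp
    have hm1 : AEStronglyMeasurable ((fun x => v (Φ^[j] x) - v x) ∘ Φ) ((surf n).restrict A) :=
      (((hc j).sub hv).comp h.contMDiff.continuous.continuousOn hΦ).aestronglyMeasurable
        hA.measurableSet
    have hm2 : AEStronglyMeasurable (fun x => v (Φ x) - v x) ((surf n).restrict A) :=
      ((hc 1).sub hv).aestronglyMeasurable hA.measurableSet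
    rw [e]
    refine (eLpNorm_add_le hm1 hm2 (by norm_num)).trans ?_
    have h1 := h.eLpNorm_comp_le (fun x => v (Φ^[j] x) - v x) hA.measurableSet
    have h2 : eLpNorm (fun x => v (Φ^[j] x) - v x) 2 ((surf n).restrict (Φ '' A)) ≤
        j * J ^ j * D :=
      (eLpNorm_mono_measure _ (Measure.restrict_mono hΦ.image_subset le_rfl)).trans ih
    calc _ ≤ J * (j * J ^ j * D) + 1 * D := by
          rw [one_mul]
          exact add_le_add (h1.trans (by gcongr)) le_rfl
      _ ≤ J * (j * J ^ j * D) + J ^ (j + 1) * D := by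
          gcongr
          exact one_le_pow₀ hJ
      _ = _ := by push_cast; ring

theorem IsQuasiIsometry.disjoint_image_iterate (h : IsQuasiIsometry J Φ) {A : Set (Sph n)}
    (hΦ : MapsTo Φ A A) {i j : ℕ} (hij : i < j) :
    Disjoint (Φ^[2 * i] '' (A \ Φ^[2] '' A)) (Φ^[2 * j] '' (A \ Φ^[2] '' A)) := by
  rw [Set.disjoint_left]
  rintro _ ⟨l, hl, rfl⟩ ⟨l', hl', he⟩
  -- Since `i < j`, the truncated subtractions are genuine. Cancelling `Φ^[2 * i]` by injectivity
  -- puts the layer point `l` in `Φ^[2] '' A`.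
  have e : 2 * j = 2 * i + (2 + (2 * (j - i) - 2)) := by omega
  rw [e, Function.iterate_add_apply] at he
  have h1 := (h.injective.iterate (2 * i)) he
  rw [Function.iterate_add_apply] at h1
  exact hl.2 ⟨_, (hΦ.iterate _) hl'.1, h1⟩

/-- Pigeonhole over `m ^ 2` disjoint subsets of `A`; squares of `L²` norms add, so the norm gains a
factor `m`. -/
theorem IsQuasiIsometry.exists_iterate_small (h : IsQuasiIsometry J Φ) {A : Set (Sph n)}
    (hA : IsOpen A) (hΦ : MapsTo Φ A A) (v : Sph n → ℝ) {m : ℕ} (hm : 0 < m) :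
    ∃ j < m ^ 2, m * eLpNorm v 2 ((surf n).restrict (Φ^[2 * j] '' (A \ Φ^[2] '' A))) ≤
      eLpNorm v 2 ((surf n).restrict A) := by
  set S : ℕ → Set (Sph n) := fun j => Φ^[2 * j] '' (A \ Φ^[2] '' A) with hS
  have hSm : ∀ j, MeasurableSet (S j) := fun j =>
    (h.measurableEmbedding_iterate _).measurableSet_image.2
      (hA.measurableSet.diff ((h.measurableEmbedding_iterate 2).measurableSet_image.2
        hA.measurableSet))
  have hdisj : Set.PairwiseDisjoint (Finset.range (m ^ 2) : Set ℕ) S := by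
    intro i _ j _ hij
    rcases lt_or_gt_of_ne hij with h1 | h1
    · exact h.disjoint_image_iterate hΦ h1
    · exact (h.disjoint_image_iterate hΦ h1).symm
  have hsum : ∑ j ∈ Finset.range (m ^ 2), eLpNorm v 2 ((surf n).restrict (S j)) ^ 2 ≤
      eLpNorm v 2 ((surf n).restrict A) ^ 2 := by
    simp only [eLpNorm_two_sq]
    rw [← lintegral_biUnion_finset hdisj fun j _ => hSm j]
    refine lintegral_mono_set ?_
    refine iUnion₂_subset fun j _ => ?_
    rintro _ ⟨x, hx, rfl⟩
    exact (hΦ.iterate _) hx.1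
  obtain ⟨j, hj, hmin⟩ := Finset.exists_min_image (Finset.range (m ^ 2))
    (fun j => eLpNorm v 2 ((surf n).restrict (S j)) ^ 2) ⟨0, Finset.mem_range.2 (by positivity)⟩
  refine ⟨j, Finset.mem_range.1 hj, ?_⟩
  rw [← ENNReal.pow_le_pow_left_iff two_ne_zero]
  refine le_trans ?_ hsum
  have := Finset.card_nsmul_le_sum _ _ _ hmin
  rw [Finset.card_range, nsmul_eq_mul] at this
  refine le_trans (le_of_eq ?_) this
  push_cast
  ring

/-- On the layer, `v` differs from `v ∘ Φ^[2 * j]` by an iterated displacement, and for a suitable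
`j` the latter has small norm. This replaces a trace or concentration estimate near the boundary. -/
theorem IsQuasiIsometry.eLpNorm_layer_le (h : IsQuasiIsometry J Φ) {A : Set (Sph n)}
    (hA : IsOpen A) (hΦ : MapsTo Φ A A) {v : Sph n → ℝ} (hv : ContinuousOn v A) {m : ℕ}
    (hm : 0 < m) :
    m * eLpNorm v 2 ((surf n).restrict (A \ Φ^[2] '' A)) ≤
      J ^ (2 * m ^ 2) * (eLpNorm v 2 ((surf n).restrict A) +
        2 * m ^ 3 * eLpNorm (fun x => v (Φ x) - v x) 2 ((surf n).restrict A)) := by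
  obtain ⟨j, hj, hsmall⟩ := h.exists_iterate_small hA hΦ v hm
  set D := eLpNorm (fun x => v (Φ x) - v x) 2 ((surf n).restrict A) with hD
  set L := A \ Φ^[2] '' A with hL
  have hLm : MeasurableSet L := hA.measurableSet.diff
    ((h.measurableEmbedding_iterate 2).measurableSet_image.2 hA.measurableSet)
  have hLA : L ⊆ A := sdiff_subset
  have hJ : (1 : ℝ≥0∞) ≤ J := by exact_mod_cast h.one_le
  have hc : ContinuousOn (fun x => v (Φ^[2 * j] x)) A :=
    hv.comp (h.contMDiff.continuous.iterate _).continuousOn (hΦ.iterate _)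
  have hm1 : AEStronglyMeasurable (v ∘ Φ^[2 * j]) ((surf n).restrict L) :=
    (hc.mono hLA).aestronglyMeasurable hLm
  have hm2 : AEStronglyMeasurable (fun x => v (Φ^[2 * j] x) - v x) ((surf n).restrict L) :=
    ((hc.sub hv).mono hLA).aestronglyMeasurable hLm
  have e : v = v ∘ Φ^[2 * j] - fun x => v (Φ^[2 * j] x) - v x := by
    funext x
    simp
  have h1 : eLpNorm v 2 ((surf n).restrict L) ≤
      J ^ (2 * j) * eLpNorm v 2 ((surf n).restrict (Φ^[2 * j] '' L)) +
        ((2 * j : ℕ) : ℝ≥0∞) * J ^ (2 * j) * D := by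
    calc eLpNorm v 2 ((surf n).restrict L)
        = eLpNorm (v ∘ Φ^[2 * j] - fun x => v (Φ^[2 * j] x) - v x) 2 ((surf n).restrict L) := by
          rw [← e]
      _ ≤ _ := eLpNorm_sub_le hm1 hm2 (by norm_num)
      _ ≤ _ := by
          refine add_le_add (h.eLpNorm_comp_iterate_le v _ hLm) ?_
          exact (eLpNorm_mono_measure _ (Measure.restrict_mono hLA le_rfl)).trans
            (h.eLpNorm_iterate_sub_le hA hΦ hv _)
  have hpow : (J : ℝ≥0∞) ^ (2 * j) ≤ J ^ (2 * m ^ 2) := pow_le_pow_right₀ hJ (by omega)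
  have hjm : ((2 * j : ℕ) : ℝ≥0∞) ≤ 2 * m ^ 2 := by
    have : 2 * j ≤ 2 * m ^ 2 := by omega
    exact_mod_cast this
  calc _ ≤ m * (J ^ (2 * m ^ 2) * eLpNorm v 2 ((surf n).restrict (Φ^[2 * j] '' L)) +
        2 * m ^ 2 * J ^ (2 * m ^ 2) * D) := by
        gcongr
        exact h1.trans (by gcongr)
    _ = J ^ (2 * m ^ 2) * (m * eLpNorm v 2 ((surf n).restrict (Φ^[2 * j] '' L)) +
        2 * m ^ 3 * D) := by ring
    _ ≤ _ := by gcongr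

theorem eLpNorm_le_add_diff {α E : Type*} [MeasurableSpace α] [NormedAddCommGroup E]
    {μ : Measure α} (f : α → E) {A B : Set α} (hB : MeasurableSet B) :
    eLpNorm f 2 (μ.restrict A) ≤ eLpNorm f 2 (μ.restrict B) + eLpNorm f 2 (μ.restrict (A \ B)) := by
  rw [← ENNReal.pow_le_pow_left_iff two_ne_zero]
  calc eLpNorm f 2 (μ.restrict A) ^ 2
      ≤ eLpNorm f 2 (μ.restrict B) ^ 2 + eLpNorm f 2 (μ.restrict (A \ B)) ^ 2 := by
        rw [eLpNorm_two_sq, eLpNorm_two_sq, eLpNorm_two_sq,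
          ← lintegral_inter_add_sdiff (μ := μ) _ A hB]
        gcongr
        exact inter_subset_right
    _ ≤ _ := by
        rw [add_sq]
        calc _ ≤ _ := le_self_add (b := 2 * eLpNorm f 2 (μ.restrict B) *
                eLpNorm f 2 (μ.restrict (A \ B)))
          _ = _ := by ring

end Layer

/-! ### The variational problem -/

/-- The set of Rayleigh quotients whose infimum is `mu1`. -/
def rayleighSet (A : Set (Sph n)) : Set ℝ :=
  {t : ℝ | ∃ p ∈ W12 A, (∫ x in A, p.1 x ∂(surf n)) = 0 ∧ p.1 ≠ 0 ∧ t = ‖p.2‖ / ‖p.1‖}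

theorem rayleighSet_nonneg (A : Set (Sph n)) : ∀ t ∈ rayleighSet A, 0 ≤ t := by
  rintro t ⟨p, -, -, -, rfl⟩
  positivity

theorem mu1_nonneg (A : Set (Sph n)) : 0 ≤ mu1 A := Real.sInf_nonneg (rayleighSet_nonneg A)

/-- Smooth functions on `A` with finite Sobolev norm. -/
structure IsTest (A : Set (Sph n)) (u : Sph n → ℝ) : Prop where
  smooth : ContMDiffOn (𝓡 n) 𝓘(ℝ, ℝ) ∞ u A
  memLp : MemLp u 2 ((surf n).restrict A)
  memLp_grad : MemLp (sphGrad u) 2 ((surf n).restrict A)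

theorem sphGrad_sub_const (u : Sph n → ℝ) (c : ℝ) : sphGrad (fun x => u x - c) = sphGrad u := by
  funext x
  have h : radialExt (fun x => u x - c) =ᶠ[𝓝 (x : Amb n)] fun y => radialExt u y - c := by
    filter_upwards [isOpen_ne.mem_nhds (coe_ne_zero x)] with z hz
    rw [radialExt_eq _ hz, radialExt_eq _ hz]
  rw [sphGrad, sphGrad, gradient, gradient, h.fderiv_eq, fderiv_sub_const]

theorem IsTest.sub_const {A : Set (Sph n)} {u : Sph n → ℝ} (h : IsTest A u) (c : ℝ) :
    IsTest A fun x => u x - c := by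
  refine ⟨h.smooth.sub contMDiffOn_const, h.memLp.sub (memLp_const c), ?_⟩
  rw [sphGrad_sub_const]
  exact h.memLp_grad

theorem IsTest.exists_div_mem_rayleighSet {A : Set (Sph n)} (hA : IsOpen A) (hne : A.Nonempty)
    {u : Sph n → ℝ} (hu : IsTest A u) :
    ∃ c : ℝ, (eLpNorm (fun x => u x - c) 2 ((surf n).restrict A)).toReal ≠ 0 →
      (eLpNorm (sphGrad u) 2 ((surf n).restrict A)).toReal /
        (eLpNorm (fun x => u x - c) 2 ((surf n).restrict A)).toReal ∈ rayleighSet A := by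
  set σ := (surf n).restrict A with hσ
  have hσ0 : σ.real univ ≠ 0 := by
    rw [hσ, measureReal_restrict_apply_univ]
    exact (ENNReal.toReal_pos (hA.measure_pos _ hne).ne' (measure_ne_top _ _)).ne'
  set c : ℝ := (σ.real univ)⁻¹ * ∫ x, u x ∂σ with hc
  refine ⟨c, fun hpos => ?_⟩
  have hw := hu.sub_const c
  refine ⟨(hw.memLp.toLp _, hu.memLp_grad.toLp _), subset_closure ?_, ?_, ?_, ?_⟩
  · refine ⟨fun x => u x - c, hw.smooth, hw.memLp.coeFn_toLp, ?_⟩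
    rw [sphGrad_sub_const]
    exact hu.memLp_grad.coeFn_toLp
  · have hui : Integrable u σ := hu.memLp.integrable (by norm_num)
    rw [integral_congr_ae hw.memLp.coeFn_toLp, integral_sub hui (integrable_const c),
      integral_const, smul_eq_mul, hc, mul_inv_cancel_left₀ hσ0, sub_self]
  · intro h
    apply hpos
    have := congrArg norm h
    simpa only [Lp.norm_toLp, norm_zero] using this
  · simp only [Lp.norm_toLp, hσ]

/-- The Poincaré inequality with `c` the mean of `u`, in product form so that it survives when `u -
c` vanishes. -/
theorem IsTest.exists_mu1_mul_le {A : Set (Sph n)} (hA : IsOpen A) (hne : A.Nonempty)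
    {u : Sph n → ℝ} (hu : IsTest A u) :
    ∃ c : ℝ, mu1 A * (eLpNorm (fun x => u x - c) 2 ((surf n).restrict A)).toReal ≤
      (eLpNorm (sphGrad u) 2 ((surf n).restrict A)).toReal := by
  obtain ⟨c, hc⟩ := hu.exists_div_mem_rayleighSet hA hne
  refine ⟨c, ?_⟩
  by_cases h : (eLpNorm (fun x => u x - c) 2 ((surf n).restrict A)).toReal = 0
  · rw [h, mul_zero]
    exact ENNReal.toReal_nonneg
  · have h1 : mu1 A ≤ _ := csInf_le ⟨0, fun t ht => rayleighSet_nonneg A t ht⟩ (hc h)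
    rwa [le_div_iff₀ (lt_of_le_of_ne ENNReal.toReal_nonneg (Ne.symm h))] at h1

/-- A function of mean zero is orthogonal to the constants. -/
theorem norm_le_norm_sub_const {α : Type*} [MeasurableSpace α] {μ : Measure α} [IsFiniteMeasure μ]
    (f : Lp ℝ 2 μ) (hf : ∫ x, f x ∂μ = 0) (c : ℝ) :
    ‖f‖ ≤ ‖f - (memLp_const c : MemLp (fun _ : α => c) 2 μ).toLp‖ := by
  set C := (memLp_const c : MemLp (fun _ : α => c) 2 μ).toLp with hC
  have h0 : ⟪f, C⟫ = 0 := by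
    rw [L2.inner_def]
    have : (fun x => ⟪f x, C x⟫) =ᵐ[μ] fun x => c * f x := by
      filter_upwards [(memLp_const c : MemLp (fun _ : α => c) 2 μ).coeFn_toLp] with x hx
      rw [hC, hx]
      simp
    rw [integral_congr_ae this, integral_const_mul, hf, mul_zero]
  have h1 := norm_sub_sq_real f C
  rw [h0] at h1
  refine le_of_sq_le_sq ?_ (norm_nonneg _)
  rw [h1]
  nlinarith [sq_nonneg ‖C‖]

/-- A smooth approximation of a near-minimiser loses the mean-zero condition. What remains, and
suffices, is a lower bound for its distance to every constant. -/
theorem exists_isTest_of_mu1_lt {A : Set (Sph n)} (hne : (rayleighSet A).Nonempty) {m : ℝ}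
    (hm : mu1 A < m) : ∃ u : Sph n → ℝ, IsTest A u ∧ ∃ ρ : ℝ, 0 < ρ ∧
      (∀ c : ℝ, ρ ≤ (eLpNorm (fun x => u x - c) 2 ((surf n).restrict A)).toReal) ∧
      (eLpNorm (sphGrad u) 2 ((surf n).restrict A)).toReal ≤ m * ρ := by
  obtain ⟨_, ⟨p, hp, hp0, hpne, rfl⟩, hlt⟩ := exists_lt_of_csInf_lt hne hm
  have hm0 : 0 < m := (mu1_nonneg A).trans_lt hm
  have hpn : 0 < ‖p.1‖ := norm_pos_iff.2 hpne
  rw [div_lt_iff₀ hpn] at hlt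
  -- The solution of `‖p.2‖ + δ = m * (‖p.1‖ - δ)`.
  set δ : ℝ := (m * ‖p.1‖ - ‖p.2‖) / (1 + m) with hδ
  have hδ0 : 0 < δ := div_pos (by linarith) (by linarith)
  have hδm : δ * (1 + m) = m * ‖p.1‖ - ‖p.2‖ := by rw [hδ]; field_simp
  obtain ⟨q, ⟨u, hu, hq1, hq2⟩, hdist⟩ := Metric.mem_closure_iff.1 hp δ hδ0
  rw [Prod.dist_eq, max_lt_iff, dist_eq_norm, dist_eq_norm] at hdist
  have hut : IsTest A u := ⟨hu, (memLp_congr_ae hq1).1 (Lp.memLp q.1),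
    (memLp_congr_ae hq2).1 (Lp.memLp q.2)⟩
  refine ⟨u, hut, ‖p.1‖ - δ, ?_, fun c => ?_, ?_⟩
  · have := norm_nonneg p.2
    by_contra! hcon
    have : m * (‖p.1‖ - δ) ≤ 0 := mul_nonpos_of_nonneg_of_nonpos hm0.le hcon
    linarith
  · have e : (eLpNorm (fun x => u x - c) 2 ((surf n).restrict A)).toReal =
        ‖q.1 - (memLp_const c : MemLp (fun _ : Sph n => c) 2 ((surf n).restrict A)).toLp‖ := by
      rw [Lp.norm_def]
      congr 1
      apply eLpNorm_congr_ae
      filter_upwards [Lp.coeFn_sub q.1 (memLp_const c : MemLp (fun _ : Sph n => c) 2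
        ((surf n).restrict A)).toLp, hq1, (memLp_const c : MemLp (fun _ : Sph n => c) 2
        ((surf n).restrict A)).coeFn_toLp] with x h1 h2 h3
      rw [h1, Pi.sub_apply, h2, h3]
    rw [e]
    set C := (memLp_const c : MemLp (fun _ : Sph n => c) 2 ((surf n).restrict A)).toLp
    have h1 := norm_le_norm_sub_const p.1 hp0 c
    have h2 : p.1 - C = (p.1 - q.1) + (q.1 - C) := by abel
    have h3 := norm_add_le (p.1 - q.1) (q.1 - C)
    rw [← h2] at h3
    change ‖p.1‖ ≤ ‖p.1 - C‖ at h1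
    linarith [hdist.1]
  · have e : (eLpNorm (sphGrad u) 2 ((surf n).restrict A)).toReal = ‖q.2‖ := by
      rw [Lp.norm_def, eLpNorm_congr_ae hq2]
    have h3 : ‖q.2‖ ≤ ‖p.2‖ + ‖p.2 - q.2‖ := by
      have := norm_sub_norm_le q.2 p.2
      rw [norm_sub_rev] at this
      linarith
    rw [e]
    linarith [hdist.2]

/-! ### Transfer along a quasi-isometry -/

theorem IsQuasiIsometry.isTest_comp {J : ℝ≥0} {Φ : Sph n → Sph n} (h : IsQuasiIsometry J Φ)
    {A A' : Set (Sph n)} (hA : IsOpen A) (hA' : IsOpen A') (hΦ : MapsTo Φ A' A) {u : Sph n → ℝ}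
    (hu : IsTest A u) : IsTest A' (u ∘ Φ) ∧
      eLpNorm (sphGrad (u ∘ Φ)) 2 ((surf n).restrict A') ≤
        J ^ 2 * eLpNorm (sphGrad u) 2 ((surf n).restrict A) := by
  have hs : ContMDiffOn (𝓡 n) 𝓘(ℝ, ℝ) ∞ (u ∘ Φ) A' := hu.smooth.comp h.contMDiff.contMDiffOn hΦ
  have hle : ∀ {E : Type} [NormedAddCommGroup E] (f : Sph n → E),
      eLpNorm (f ∘ Φ) 2 ((surf n).restrict A') ≤ J * eLpNorm f 2 ((surf n).restrict A) := by
    intro E _ f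
    refine (h.eLpNorm_comp_le f hA'.measurableSet).trans ?_
    gcongr
    exact hΦ.image_subset
  have hg : eLpNorm (sphGrad (u ∘ Φ)) 2 ((surf n).restrict A') ≤
      J ^ 2 * eLpNorm (sphGrad u) 2 ((surf n).restrict A) := by
    calc _ ≤ J * eLpNorm (sphGrad u ∘ Φ) 2 ((surf n).restrict A') := by
          have := eLpNorm_le_mul_eLpNorm_of_ae_le_mul (f := sphGrad (u ∘ Φ)) (g := sphGrad u ∘ Φ)
            (c := J) (μ := (surf n).restrict A') ((ae_restrict_iff' hA'.measurableSet).2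
            (Eventually.of_forall fun x hx => h.norm_sphGrad_le A hA u hu.smooth x (hΦ hx))) 2
          rwa [ENNReal.ofReal_coe_nnreal] at this
      _ ≤ J * (J * eLpNorm (sphGrad u) 2 ((surf n).restrict A)) := by
          gcongr
          exact hle _
      _ = _ := by ring
  refine ⟨⟨hs, ⟨hs.continuousOn.aestronglyMeasurable hA'.measurableSet, ?_⟩,
    ⟨(continuousOn_sphGrad hA' hs).aestronglyMeasurable hA'.measurableSet, ?_⟩⟩, hg⟩
  · exact (hle u).trans_lt (ENNReal.mul_lt_top ENNReal.coe_lt_top hu.memLp.2)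
  · exact hg.trans_lt (ENNReal.mul_lt_top (by simp) hu.memLp_grad.2)

/-- Of the factor `J ^ 3`, two powers come from the gradient of `u ∘ Φ` and one from its `L²` norm;
`4 / m` is the share of the layer. -/
theorem IsQuasiIsometry.mu1_mul_le {J : ℝ≥0} {Φ : Sph n → Sph n} (h : IsQuasiIsometry J Φ)
    {A A' : Set (Sph n)} (hA : IsOpen A) (hA' : IsOpen A') (hne' : A'.Nonempty)
    (hR : (rayleighSet A).Nonempty) (hAA : MapsTo Φ A A) (hA'A : MapsTo Φ A' A)
    (hAA' : MapsTo Φ A A') {κ : ℝ} (hκ : 0 ≤ κ)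
    (hdisp : ∀ v : Sph n → ℝ, ContMDiffOn (𝓡 n) 𝓘(ℝ, ℝ) ∞ v A →
      eLpNorm (fun x => v (Φ x) - v x) 2 ((surf n).restrict A) ≤
        ENNReal.ofReal κ * eLpNorm (sphGrad v) 2 ((surf n).restrict A))
    {m : ℕ} (hm : 0 < m) (hJ : J ^ (2 * m ^ 2) ≤ 2) {K : ℝ} (hK : mu1 A < K)
    (hκm : 2 * (m : ℝ) ^ 3 * κ * K ≤ 1) : mu1 A' * (1 - 4 / m) ≤ J ^ 3 * mu1 A := by
  have hm0 : (0 : ℝ) < m := by exact_mod_cast hm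
  -- The infimum need not be attained: work with `k` slightly larger and let it decrease to `mu1 A`.
  have key : ∀ k, mu1 A < k → k ≤ K → mu1 A' * (1 - 4 / m) ≤ J ^ 3 * k := by
    intro k hk hkK
    obtain ⟨u, hu, ρ, hρ, hlow, hgrad⟩ := exists_isTest_of_mu1_lt hR hk
    obtain ⟨hw, hwg⟩ := h.isTest_comp hA hA' hA'A hu
    -- The constant is adapted to `u ∘ Φ` on `A'`, not to `u` on `A`; hence the bound `hlow` for all
    -- constants.
    obtain ⟨c, hc⟩ := hw.exists_mu1_mul_le hA' hne'
    have hv := hu.sub_const c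
    set v : Sph n → ℝ := fun x => u x - c with hvdef
    have hvc := hv.smooth.continuousOn
    have hvg : sphGrad v = sphGrad u := sphGrad_sub_const u c
    set N₀ := (eLpNorm v 2 ((surf n).restrict A)).toReal with hN₀
    set N₁ := (eLpNorm (sphGrad u) 2 ((surf n).restrict A)).toReal with hN₁
    set W := (eLpNorm (fun x => (u ∘ Φ) x - c) 2 ((surf n).restrict A')).toReal with hW
    set ℓ := (eLpNorm v 2 ((surf n).restrict (A \ Φ^[2] '' A))).toReal with hℓ
    have f₀ : eLpNorm v 2 ((surf n).restrict A) = ENNReal.ofReal N₀ :=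
      (ENNReal.ofReal_toReal hv.memLp.2.ne).symm
    have f₁ : eLpNorm (sphGrad u) 2 ((surf n).restrict A) = ENNReal.ofReal N₁ :=
      (ENNReal.ofReal_toReal hu.memLp_grad.2.ne).symm
    have fW : eLpNorm (fun x => (u ∘ Φ) x - c) 2 ((surf n).restrict A') = ENNReal.ofReal W :=
      (ENNReal.ofReal_toReal (hw.sub_const c).memLp.2.ne).symm
    have hℓfin : eLpNorm v 2 ((surf n).restrict (A \ Φ^[2] '' A)) ≠ ⊤ :=
      ((eLpNorm_mono_measure v (Measure.restrict_mono sdiff_subset le_rfl)).trans_lt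
        hv.memLp.2).ne
    have fℓ : eLpNorm v 2 ((surf n).restrict (A \ Φ^[2] '' A)) = ENNReal.ofReal ℓ :=
      (ENNReal.ofReal_toReal hℓfin).symm
    have hN₀0 : 0 ≤ N₀ := ENNReal.toReal_nonneg
    have hN₁0 : 0 ≤ N₁ := ENNReal.toReal_nonneg
    have hW0 : 0 ≤ W := ENNReal.toReal_nonneg
    have hℓ0 : 0 ≤ ℓ := ENNReal.toReal_nonneg
    have hJ1 : (1 : ℝ) ≤ J := by exact_mod_cast h.one_le
    have hρN : ρ ≤ N₀ := hlow c
    have hk0 : 0 < k := (mu1_nonneg A).trans_lt hk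
    have hN1k : N₁ ≤ k * N₀ := hgrad.trans (by gcongr)
    have h1 := h.eLpNorm_layer_le hA hAA hvc hm
    have h2 : (m : ℝ≥0∞) * ENNReal.ofReal ℓ ≤
        2 * (ENNReal.ofReal N₀ + 2 * m ^ 3 * (ENNReal.ofReal κ * ENNReal.ofReal N₁)) := by
      rw [← fℓ, ← f₀, ← f₁, ← hvg]
      refine h1.trans ?_
      gcongr
      · exact_mod_cast hJ
      · exact hdisp v hv.smooth
    have h3 : m * ℓ ≤ 2 * (N₀ + 2 * m ^ 3 * (κ * N₁)) := by
      have e1 : (m : ℝ≥0∞) = ENNReal.ofReal m := (ENNReal.ofReal_natCast m).symm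
      have e2 : (2 : ℝ≥0∞) = ENNReal.ofReal 2 := by simp
      rw [e1, e2, ← ENNReal.ofReal_pow hm0.le, ← ENNReal.ofReal_mul hκ,
        ← ENNReal.ofReal_mul hm0.le, ← ENNReal.ofReal_mul (by norm_num),
        ← ENNReal.ofReal_mul (by positivity), ← ENNReal.ofReal_add hN₀0 (by positivity),
        ← ENNReal.ofReal_mul (by norm_num)] at h2
      exact (ENNReal.ofReal_le_ofReal_iff (by positivity)).1 h2
    have h4 : m * ℓ ≤ 4 * N₀ := by
      have : 2 * (m : ℝ) ^ 3 * (κ * N₁) ≤ N₀ := by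
        calc _ ≤ 2 * (m : ℝ) ^ 3 * (κ * (K * N₀)) := by gcongr; exact hN1k.trans (by gcongr)
          _ = (2 * (m : ℝ) ^ 3 * κ * K) * N₀ := by ring
          _ ≤ 1 * N₀ := by gcongr
          _ = N₀ := one_mul _
      linarith
    have h5 : ℓ ≤ 4 / m * N₀ := by
      rw [div_mul_eq_mul_div, le_div_iff₀ hm0]
      linarith
    have h6 : N₀ ≤ J * W + ℓ := by
      have hB : MeasurableSet (Φ^[2] '' A) :=
        (h.measurableEmbedding_iterate 2).measurableSet_image.2 hA.measurableSet
      have hsub : Φ^[2] '' A ⊆ Φ '' A' := by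
        rintro _ ⟨x, hx, rfl⟩
        exact ⟨Φ x, hAA' hx, rfl⟩
      have := eLpNorm_le_add_diff (μ := surf n) v (A := A) hB
      have h7 : eLpNorm v 2 ((surf n).restrict (Φ^[2] '' A)) ≤ J * ENNReal.ofReal W := by
        rw [← fW]
        exact (eLpNorm_mono_measure v (Measure.restrict_mono hsub le_rfl)).trans
          (h.eLpNorm_image_le v hA'.measurableSet)
      have h8 : ENNReal.ofReal N₀ ≤ J * ENNReal.ofReal W + ENNReal.ofReal ℓ := by
        rw [← f₀, ← fℓ]
        exact this.trans (add_le_add h7 le_rfl)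
      rw [← ENNReal.ofReal_coe_nnreal, ← ENNReal.ofReal_mul J.coe_nonneg,
        ← ENNReal.ofReal_add (by positivity) hℓ0] at h8
      exact (ENNReal.ofReal_le_ofReal_iff (by positivity)).1 h8
    have h9 : mu1 A' * W ≤ J ^ 2 * N₁ := by
      refine hc.trans ?_
      have := ENNReal.toReal_mono (ENNReal.mul_ne_top (by simp) hu.memLp_grad.2.ne) hwg
      rwa [ENNReal.toReal_mul, ENNReal.toReal_pow, ENNReal.coe_toReal] at this
    have hμ := mu1_nonneg A'
    have h10 : mu1 A' * ((1 - 4 / m) * N₀) ≤ J ^ 3 * k * N₀ := by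
      calc mu1 A' * ((1 - 4 / m) * N₀) ≤ mu1 A' * (J * W) :=
            mul_le_mul_of_nonneg_left (by linarith) hμ
        _ = J * (mu1 A' * W) := by ring
        _ ≤ J * (J ^ 2 * (k * N₀)) :=
            mul_le_mul_of_nonneg_left (h9.trans (by gcongr)) J.coe_nonneg
        _ = _ := by ring
    rw [← mul_assoc] at h10
    exact le_of_mul_le_mul_right h10 (hρ.trans_le hρN)
  have hlim : Tendsto (fun k : ℝ => (J : ℝ) ^ 3 * k) (𝓝[>] mu1 A) (𝓝 (J ^ 3 * mu1 A)) :=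
    ((continuous_const.mul continuous_id).tendsto _).mono_left nhdsWithin_le_nhds
  refine ge_of_tendsto hlim ?_
  filter_upwards [Ioc_mem_nhdsGT hK] with k hk
  exact key k hk.1 hk.2

/-! ### Uniform upper bound -/

theorem contMDiff_coord (i : Fin (n + 1)) :
    ContMDiff (𝓡 n) 𝓘(ℝ, ℝ) ∞ (fun x : Sph n => (x : Amb n) i) := by
  have : Fact (Module.finrank ℝ (Amb n) = n + 1) := ⟨finrank_euclideanSpace_fin⟩
  have h1 : ContMDiff (𝓡 n) 𝓘(ℝ, Amb n) ∞ (fun x : Sph n => (x : Amb n)) := contMDiff_coe_sphere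
  have h2 : ContDiff ℝ ∞ fun y : Amb n => y i := by fun_prop
  exact h2.contMDiff.comp h1

theorem memLp_of_continuous {E : Type*} [NormedAddCommGroup E] {f : Sph n → E} (hf : Continuous f)
    (A : Set (Sph n)) : MemLp f 2 ((surf n).restrict A) := by
  obtain ⟨C, hC⟩ := isCompact_univ.exists_bound_of_continuousOn hf.continuousOn
  exact MemLp.of_bound hf.aestronglyMeasurable C (Eventually.of_forall fun x => hC x (mem_univ x))

theorem continuous_sphGrad_coord (i : Fin (n + 1)) :
    Continuous (sphGrad fun x : Sph n => (x : Amb n) i) :=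
  continuousOn_univ.1 (continuousOn_sphGrad isOpen_univ (contMDiff_coord i).contMDiffOn)

theorem isTest_coord (i : Fin (n + 1)) (A : Set (Sph n)) :
    IsTest A fun x => (x : Amb n) i :=
  ⟨(contMDiff_coord i).contMDiffOn, memLp_of_continuous (contMDiff_coord i).continuous A,
    memLp_of_continuous (continuous_sphGrad_coord i) A⟩

theorem exists_ne_mem_of_isOpen (hn : 1 ≤ n) {U : Set (Sph n)} (hU : IsOpen U)
    (hne : U.Nonempty) : ∃ p ∈ U, ∃ q ∈ U, ∃ i, (p : Amb n) i ≠ (q : Amb n) i := by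
  have := preconnectedSpace_sphere hn
  obtain ⟨p, hp⟩ := hne
  by_contra! hcon
  have hUp : U = {p} := by
    refine eq_singleton_iff_unique_mem.2 ⟨hp, fun q hq => ?_⟩
    apply Subtype.ext
    ext i
    exact (hcon p hp q hq i).symm
  have hcl : IsClopen U := ⟨hUp ▸ isClosed_singleton, hU⟩
  rcases isClopen_iff.1 hcl with h | h
  · rw [h] at hp
    exact hp
  · have h1 : -p ∈ U := h ▸ mem_univ _
    rw [hUp, mem_singleton_iff] at h1
    have h2 : -(p : Amb n) = p := congrArg Subtype.val h1
    have h3 : (2 : ℝ) • (p : Amb n) = 0 := by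
      rw [two_smul]
      nth_rewrite 1 [← h2]
      exact neg_add_cancel _
    exact (smul_eq_zero.1 h3).elim two_ne_zero (coe_ne_zero p)

/-- A coordinate function that is not constant on `U` is a test function for all `A` at once.
Non-emptiness is recorded because `sInf ∅ = 0` would give no near-minimisers. -/
theorem exists_bound_mu1_of_superset (hn : 1 ≤ n) {U : Set (Sph n)} (hU : IsOpen U)
    (hne : U.Nonempty) :
    ∃ B : ℝ, ∀ A, IsOpen A → U ⊆ A → (rayleighSet A).Nonempty ∧ mu1 A ≤ B := by
  obtain ⟨p, hp, q, hq, i, hpq⟩ := exists_ne_mem_of_isOpen hn hU hne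
  set u : Sph n → ℝ := fun x => (x : Amb n) i with hu
  have huc : Continuous u := (contMDiff_coord i).continuous
  -- Every `c` is at distance at least `2 * h` from `u p` or from `u q`, hence at least `h` from `u`
  -- on a neighbourhood of that point.
  set h : ℝ := |u p - u q| / 4 with hh
  have hh0 : 0 < h := div_pos (abs_pos.2 (sub_ne_zero.2 hpq)) (by norm_num)
  have piece : ∀ a ∈ U, ∃ ℓ : ℝ≥0∞, ℓ ≠ 0 ∧ ∀ c : ℝ, 2 * h ≤ |u a - c| → ∀ A, U ⊆ A →
      ℓ ≤ eLpNorm (fun x => u x - c) 2 ((surf n).restrict A) := by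
    intro a ha
    set V : Set (Sph n) := U ∩ {x | |u x - u a| < h} with hV
    have hVo : IsOpen V := hU.inter (isOpen_lt (by fun_prop) continuous_const)
    have hVne : V.Nonempty := ⟨a, ha, by simpa using hh0⟩
    have hVpos := hVo.measure_pos (surf n) hVne
    refine ⟨eLpNorm (fun _ : Sph n => h) 2 ((surf n).restrict V), ?_, fun c hc A hUA => ?_⟩
    · rw [Ne, eLpNorm_eq_zero_iff aestronglyMeasurable_const (by norm_num)]
      intro h0
      have h1 : ∀ᵐ _ ∂((surf n).restrict V), False := by
        filter_upwards [h0] with x hx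
        exact hh0.ne' hx
      rw [ae_iff] at h1
      simp only [not_false_eq_true] at h1
      rw [show {x : Sph n | True} = univ from rfl, Measure.restrict_apply_univ] at h1
      exact hVpos.ne' h1
    · refine le_trans (eLpNorm_mono_ae (g := fun x => u x - c) ?_)
        (eLpNorm_mono_measure _ (Measure.restrict_mono (inter_subset_left.trans hUA) le_rfl))
      refine (ae_restrict_iff' hVo.measurableSet).2 (Eventually.of_forall fun x hx => ?_)
      rw [Real.norm_eq_abs, Real.norm_eq_abs, abs_of_pos hh0]
      have h1 : |u x - u a| < h := hx.2
      have h2 := abs_sub_abs_le_abs_sub (u a - c) (u a - u x)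
      rw [show u a - c - (u a - u x) = u x - c by ring, abs_sub_comm (u a) (u x)] at h2
      linarith
  obtain ⟨ℓp, hℓp, hbp⟩ := piece p hp
  obtain ⟨ℓq, hℓq, hbq⟩ := piece q hq
  have hlow : ∀ A, U ⊆ A → ∀ c : ℝ,
      min ℓp ℓq ≤ eLpNorm (fun x => u x - c) 2 ((surf n).restrict A) := by
    intro A hUA c
    rcases le_or_gt (2 * h) |u p - c| with hc | hc
    · exact (min_le_left _ _).trans (hbp c hc A hUA)
    · refine (min_le_right _ _).trans (hbq c ?_ A hUA)
      have h1 : |u p - u q| ≤ |u p - c| + |u q - c| := by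
        have := abs_sub_le (u p) c (u q)
        rwa [abs_sub_comm c (u q)] at this
      have h2 : |u p - u q| = 4 * h := by rw [hh]; ring
      linarith
  set ℓ : ℝ≥0∞ := min ℓp ℓq with hℓ
  have hℓ0 : ℓ ≠ 0 := by
    rw [hℓ]
    exact (lt_min (pos_iff_ne_zero.2 hℓp) (pos_iff_ne_zero.2 hℓq)).ne'
  have hℓtop : ℓ ≠ ⊤ := ne_top_of_le_ne_top
    ((isTest_coord i univ).sub_const 0).memLp.2.ne (hlow univ (subset_univ _) 0)
  have hℓr : 0 < ℓ.toReal := ENNReal.toReal_pos hℓ0 hℓtop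
  refine ⟨(eLpNorm (sphGrad u) 2 ((surf n).restrict univ)).toReal / ℓ.toReal, fun A hA hUA => ?_⟩
  obtain ⟨c, hc⟩ := (isTest_coord i A).exists_div_mem_rayleighSet hA (hne.mono hUA)
  have h1 : ℓ.toReal ≤ (eLpNorm (fun x => u x - c) 2 ((surf n).restrict A)).toReal :=
    ENNReal.toReal_mono ((isTest_coord i A).sub_const c).memLp.2.ne (hlow A hUA c)
  have hmem := hc (hℓr.trans_le h1).ne'
  refine ⟨⟨_, hmem⟩, (csInf_le ⟨0, fun t ht => rayleighSet_nonneg A t ht⟩ hmem).trans ?_⟩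
  gcongr
  · exact (isTest_coord i univ).memLp_grad.2.ne
  · exact subset_univ A

/-- A ball of radius `σ` contains one of finitely many balls of radius `σ / 2` centred at a net,
which makes the bound independent of its position. -/
theorem exists_bound_mu1 (hn : 1 ≤ n) {σ : ℝ} (hσ : 0 < σ) :
    ∃ B : ℝ, 0 < B ∧ ∀ A : Set (Sph n), IsOpen A →
      (∃ b : Sph n, ∀ z : Sph n, ‖(z : Amb n) - b‖ ≤ σ → z ∈ A) →
      (rayleighSet A).Nonempty ∧ mu1 A ≤ B := by
  obtain ⟨T, hT⟩ := exists_finset_net n (half_pos hσ)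
  have hex : ∀ c : Sph n, ∃ B : ℝ, ∀ A, IsOpen A → {x : Sph n | ‖(x : Amb n) - c‖ < σ / 2} ⊆ A →
      (rayleighSet A).Nonempty ∧ mu1 A ≤ B := fun c =>
    exists_bound_mu1_of_superset hn (isOpen_lt (by fun_prop) continuous_const)
      ⟨c, by simpa using hσ⟩
  choose B hB using hex
  obtain ⟨M, hM⟩ := (T.image B).exists_le
  refine ⟨max M 1, by positivity, fun A hA ⟨b, hb⟩ => ?_⟩
  obtain ⟨c, hcT, hbc⟩ := hT b
  obtain ⟨h1, h2⟩ := hB c A hA fun x (hx : ‖(x : Amb n) - c‖ < σ / 2) => by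
    apply hb
    have e : (x : Amb n) - b = ((x : Amb n) - c) - ((b : Amb n) - c) := by abel
    rw [e]
    linarith [norm_sub_le ((x : Amb n) - c) ((b : Amb n) - c)]
  exact ⟨h1, (h2.trans (hM _ (Finset.mem_image_of_mem B hcT))).trans (le_max_left _ _)⟩

/-! ### Continuity -/

theorem exists_delta_mu1_lt (hn : 1 ≤ n) {η r : ℝ} (hη : 0 < η) (hr : 0 < r) {ε : ℝ}
    (hε : 0 < ε) : ∃ δ : ℝ, 0 < δ ∧ ∀ A ∈ uniformClass n η r, A.Nonempty →
      ∀ A' ∈ uniformClass n η r, A'.Nonempty →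
        geoHausdorff (frontier A') (frontier A) < ENNReal.ofReal δ → mu1 A' - mu1 A < ε := by
  obtain ⟨M, t₀, hM, ht₀, hpush⟩ := exists_pushing_fields hn hη hr
  obtain ⟨B, hB, hbound⟩ := exists_bound_mu1 hn (σ := t₀ / 16) (by positivity)
  have hM0 : 0 < M := by linarith
  have hbd : ∀ A ∈ uniformClass n η r, A.Nonempty → (rayleighSet A).Nonempty ∧ mu1 A ≤ B := by
    rintro A hA ⟨a, ha⟩
    obtain ⟨X, -, hin, -⟩ := hpush A hA
    exact hbound A hA.1 ⟨push X t₀ a, hin t₀ ht₀ le_rfl a ha⟩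
  -- Half of `ε` pays for the layer through `4 / m * B`, the other half for the distortion through
  -- `(J ^ 3 - 1) * B`.
  obtain ⟨m, hm⟩ := exists_nat_gt (8 * B / ε)
  have hm0 : (0 : ℝ) < m := lt_of_le_of_lt (by positivity) hm
  have hmpos : 0 < m := by exact_mod_cast hm0
  have hmB : 4 / m * B < ε / 2 := by
    rw [div_lt_iff₀ hε] at hm
    rw [div_mul_eq_mul_div, div_lt_iff₀ hm0]
    linarith
  have hJex : ∃ J : ℝ≥0, 1 < J ∧ J ^ (2 * m ^ 2) ≤ 2 ∧ ((J : ℝ) ^ 3 - 1) * B ≤ ε / 2 := by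
    have h1 : ∀ᶠ J : ℝ≥0 in 𝓝 (1 : ℝ≥0), J ^ (2 * m ^ 2) < 2 := by
      apply (continuous_pow (M := ℝ≥0) _).continuousAt.eventually_lt continuousAt_const
      simp
    have h2 : ∀ᶠ J : ℝ≥0 in 𝓝 (1 : ℝ≥0), ((J : ℝ) ^ 3 - 1) * B < ε / 2 := by
      have hc : ContinuousAt (fun J : ℝ≥0 => ((J : ℝ) ^ 3 - 1) * B) 1 := by fun_prop
      apply hc.eventually_lt continuousAt_const
      simpa using hε
    have h3 := (h1.and h2).filter_mono (nhdsWithin_le_nhds (s := Ioi 1))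
    obtain ⟨J, ⟨hJ1, hJ2⟩, hJ3⟩ := (h3.and self_mem_nhdsWithin).exists
    exact ⟨J, hJ3, hJ1.le, hJ2.le⟩
  obtain ⟨J, hJ1, hJ2, hJ3⟩ := hJex
  obtain ⟨t₁, ht₁, hquasi⟩ := exists_time_isQuasiIsometry n hM0 hJ1
  -- `c * t ≤ 1` is the smallness condition of `IsQuasiIsometry.mu1_mul_le` for displacement
  -- constant `2 * M * t * J` and `K = B + 1`.
  set c : ℝ := 2 * (m : ℝ) ^ 3 * (2 * M * J) * (B + 1) with hc
  have hJ0 : (0 : ℝ) < J := by exact_mod_cast zero_lt_one.trans hJ1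
  have hc0 : 0 < c := by positivity
  set t : ℝ := min (min t₀ t₁) (1 / c) with ht
  have ht0 : 0 < t := by positivity
  have htt₀ : t ≤ t₀ := (min_le_left _ _).trans (min_le_left _ _)
  have htt₁ : t ≤ t₁ := (min_le_left _ _).trans (min_le_right _ _)
  have htc : c * t ≤ 1 := by
    have := min_le_right (min t₀ t₁) (1 / c)
    rw [← ht, le_div_iff₀ hc0] at this
    linarith
  refine ⟨t / 1280 * t₀, by positivity, fun A hA hne A' hA' hne' hdist => ?_⟩
  obtain ⟨X, hX, hin, hnear⟩ := hpush A hA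
  obtain ⟨hA'A, hAA'⟩ := hnear t ht0 htt₀ A' hA' hdist
  have hself : ∀ s, 0 ≤ s → s ≤ t → ∀ x ∈ A, push X s x ∈ A := by
    intro s hs hst x hx
    rcases hs.eq_or_lt with rfl | hs0
    · simpa [push, proj_coe] using hx
    · exact hin s hs0 (hst.trans htt₀) x hx _ (by rw [sub_self, norm_zero]; positivity)
  obtain ⟨htM, hq⟩ := hquasi X hX t ht0.le htt₁
  obtain ⟨hR, hAB⟩ := hbd A hA hne
  have hA'B := (hbd A' hA' hne').2
  have key := hq.mu1_mul_le hA.1 hA'.1 hne' hR (hself t ht0.le le_rfl) hA'A hAA'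
    (κ := 2 * M * t * J) (by positivity) (fun v hv => by
      have := hX.eLpNorm_push_sub_le hM0.le ht0.le htM
        (fun s hs hst => (hquasi X hX s hs (hst.trans htt₁)).2) hA.1 hself hv
      rwa [ENNReal.ofReal_mul (by positivity), ENNReal.ofReal_coe_nnreal])
    hmpos hJ2 (K := B + 1) (by linarith) (by
      refine le_trans (le_of_eq ?_) htc
      rw [hc]; ring)
  have h1 : ((J : ℝ) ^ 3 - 1) * mu1 A ≤ ((J : ℝ) ^ 3 - 1) * B := by
    have : (1 : ℝ) ≤ (J : ℝ) ^ 3 := one_le_pow₀ (by exact_mod_cast hJ1.le)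
    exact mul_le_mul_of_nonneg_left hAB (by linarith)
  have h2 : 4 / m * mu1 A' ≤ 4 / m * B := by gcongr
  have h3 : mu1 A' * (1 - 4 / m) = mu1 A' - 4 / m * mu1 A' := by ring
  linarith

theorem geoHausdorff_comm (X Y : Set (Sph n)) : geoHausdorff X Y = geoHausdorff Y X := by
  have h (x y : Sph n) : geoDist x y = geoDist y x := InnerProductGeometry.angle_comm _ _
  rw [geoHausdorff, geoHausdorff, sup_comm]
  exact congrArg₂ (· ⊔ ·)
    (iSup_congr fun y => iSup_congr fun _ => iInf_congr fun x => iInf_congr fun _ => by rw [h])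
    (iSup_congr fun x => iSup_congr fun _ => iInf_congr fun y => iInf_congr fun _ => by rw [h])

end AlmostConvexCones

end

theorem corollary2p4 (n : ℕ) (hn : 3 ≤ n + 1) (η r : ℝ) (hη : 0 < η) (hr : 0 < r) :
    ∀ ε : ℝ, 0 < ε → ∃ δ : ℝ, 0 < δ ∧
      ∀ A ∈ AlmostConvexCones.uniformClass n η r, A.Nonempty →
      ∀ A' ∈ AlmostConvexCones.uniformClass n η r, A'.Nonempty →
        AlmostConvexCones.geoHausdorff (frontier A') (frontier A) < ENNReal.ofReal δ →
          |AlmostConvexCones.mu1 A' - AlmostConvexCones.mu1 A| < ε := by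
  intro ε hε
  obtain ⟨δ, hδ, h⟩ := AlmostConvexCones.exists_delta_mu1_lt (n := n) (by omega) hη hr hε
  refine ⟨δ, hδ, fun A hA hne A' hA' hne' hd => ?_⟩
  have h1 := h A hA hne A' hA' hne' hd
  have h2 := h A' hA' hne' A hA hne (by rwa [AlmostConvexCones.geoHausdorff_comm])
  rw [abs_sub_lt_iff]
  exact ⟨h1, h2⟩
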